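/- Let $k$ be a field and let $Q$ be a finite quiver with vertex set $Q_0$; write $h(a)$ and $t(a)$ for the head and tail of an arrow $a$, and compose paths from right to left, so that $pq$ is defined when $t(p)=h(q)$. Suppose that $Q$ is biserial, meaning that every vertex is the head of at most two arrows and the tail of at most two arrows. Let $Z$ be a set of paths of length at least $2$ in $Q$ such that $(Q,Z)$ is special, meaning that for every arrow $b$ there is at most one arrow $a$ with $t(a)=h(b)$ and $ab\notin Z$, and at most one arrow $c$ with $h(c)=t(b)$ and $bc\notin Z$. Let $B$ be the ideal of the path algebra $kQ$ generated by the arrows, let $\overline{kQ}=\varprojlim_d kQ/B^d$ be the completion of $kQ$ in the $B$-adic topology, and let $\overline{\langle Z\rangle}$ be the closure in $\overline{kQ}$ of the ideal $\langle Z\rangle$ of $kQ$, that is, the ideal of those $x\in\overline{kQ}$ such that for every $d$ the image of $x$ in $kQ/B^d$ is the image of an element of $\langle Z\rangle$. The quotient $\Gamma=\overline{kQ}/\overline{\langle Z\rangle}$ is called a completed string algebra. A path is $Z$-admissible if no element of $Z$ is a subpath of it. A cycle is a path of positive length with the same head and tail; a cycle is $Z$-primitive if all its powers are $Z$-admissible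 and it is not a power of a shorter cycle. Let $V(c)$ be the set of vertices traversed by a cycle $c$, let $V=\bigcup_c V(c)$ where $c$ runs through the $Z$-primitive cycles, and let $V=V[1]\sqcup\dots\sqcup V[n]$ be the partition of $V$ into the classes of the equivalence relation generated by $\bigcup_c V(c)\times V(c)$ (with the classes enumerated in any order). Let $e_v$ denote the trivial path at a vertex $v$, and let $\sigma_v$ be the (finite) sum of the $Z$-primitive cycles at $v$. Let $R=k[[t_1,\dots,t_n]]$ and let $I$ be the ideal $$I=\langle Z\rangle+\sum_{i=1}^{n}\Big(\langle t_ie_v-\sigma_v \mid v\in V[i]\rangle+\langle t_ie_v\mid v\in Q_0\setminus V[i]\rangle\Big)$$ of the path algebra $RQ$. Then $\Gamma$ and $RQ/I$ are isomorphic as $k$-algebras. -/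

import Mathlib

open Quiver

noncomputable section

namespace StringAlg

universe u v w

/-! ### Paths in a quiver

A path `a_n ⋯ a_1` with tail `x` and head `y` is a term of Mathlib's `Quiver.Path x y`.
Mathlib composes paths in the order of traversal, so the product `p q` of two paths, which is
written from right to left and which is defined when `t(p) = h(q)`, is `q.comp p`. -/

section Paths

variable {Q : Type u} [Quiver.{v} Q]

variable (Q) in
/-- The type of all paths of a quiver, packaged as (tail, head, path). -/
abbrev AnyPath : Type max u v := Σ x y : Q, Quiver.Path x y

/-- A quiver is biserial if every vertex is the head of at most two arrows and
the tail of at most two arrows. -/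
def IsBiserial (Q : Type u) [Quiver.{v} Q] : Prop :=
  ∀ x : Q, (ENat.card (Quiver.Costar x) ≤ 2) ∧ (ENat.card (Quiver.Star x) ≤ 2)

/-- The path `a b` of length two: first `b`, then `a`. -/
def twoPath {x y z : Q} (a : y ⟶ z) (b : x ⟶ y) : AnyPath Q :=
  ⟨x, z, b.toPath.comp a.toPath⟩

/-- `(Q, Z)` is special: for any arrow `b` there is at most one arrow `a` with `t(a) = h(b)` and
`a b ∉ Z`, and at most one arrow `c` with `h(c) = t(b)` and `b c ∉ Z`. -/
def IsSpecial (Z : Set (AnyPath Q)) : Prop :=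
  (∀ ⦃x y : Q⦄ (b : x ⟶ y), {a : Quiver.Star y | twoPath a.2 b ∉ Z}.Subsingleton) ∧
  (∀ ⦃x y : Q⦄ (b : x ⟶ y), {c : Quiver.Costar x | twoPath b c.2 ∉ Z}.Subsingleton)

/-- A path is `Z`-admissible if it has no subpath in `Z`. -/
def IsAdmissible (Z : Set (AnyPath Q)) {x y : Q} (p : Quiver.Path x y) : Prop :=
  ∀ (x' y' : Q) (q : Quiver.Path x x') (z : Quiver.Path x' y') (r : Quiver.Path y' y),
    p = (q.comp z).comp r → (⟨x', y', z⟩ : AnyPath Q) ∉ Z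

/-- The `m`-th power of a closed path. -/
def pathPow {x : Q} (c : Quiver.Path x x) : ℕ → Quiver.Path x x
  | 0 => Quiver.Path.nil
  | m + 1 => (pathPow c m).comp c

/-- A cycle (non-trivial closed path) is `Z`-primitive if all its powers are `Z`-admissible and it
is not a power of a shorter cycle. -/
def IsPrimitive (Z : Set (AnyPath Q)) {x : Q} (c : Quiver.Path x x) : Prop :=
  0 < c.length ∧ (∀ m : ℕ, 1 ≤ m → IsAdmissible Z (pathPow c m)) ∧
    ∀ d : Quiver.Path x x, 0 < d.length → d.length < c.length → ∀ m : ℕ, c ≠ pathPow d m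

/-- The set `V(p)` of the vertices traversed by a path `p`. -/
def traversed {x y : Q} (p : Quiver.Path x y) : Set Q :=
  {z | ∃ (q : Quiver.Path x z) (r : Quiver.Path z y), p = q.comp r}

/-- The set `V` of primitive vertices: those traversed by some `Z`-primitive cycle. -/
def primitiveVertices (Z : Set (AnyPath Q)) : Set Q :=
  {z | ∃ (x : Q) (c : Quiver.Path x x), IsPrimitive Z c ∧ z ∈ traversed c}

/-- The relation `⋃_c V(c) × V(c)` on `V`, where `c` runs through the `Z`-primitive cycles. -/
def nerveRel (Z : Set (AnyPath Q)) (y z : primitiveVertices Z) : Prop :=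
  ∃ (x : Q) (c : Quiver.Path x x), IsPrimitive Z c ∧ y.1 ∈ traversed c ∧ z.1 ∈ traversed c

/-- The set of parts of the primitive-nerve partition: the classes of the equivalence relation on
`V` generated by `nerveRel`. -/
def NerveParts (Z : Set (AnyPath Q)) : Type u :=
  Quotient (Relation.EqvGen.setoid (nerveRel Z))

instance [Finite Q] (Z : Set (AnyPath Q)) : Finite (NerveParts Z) :=
  inferInstanceAs (Finite (Quotient _))

/-- The part `V[i]`, as a set of vertices, for an enumeration `e` of the parts of the
primitive-nerve partition by a type `ι` of indices. -/
def part {Z : Set (AnyPath Q)} {ι : Type w} (e : ι ≃ NerveParts Z) (i : ι) : Set Q :=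
  {z | ∃ hz : z ∈ primitiveVertices Z,
    (Quotient.mk (Relation.EqvGen.setoid (nerveRel Z)) ⟨z, hz⟩ : NerveParts Z) = e i}

end Paths

/-! ### Path algebras -/

/-- The path algebra `R Q`: the free `R`-module on the paths of `Q`. -/
def PathAlgebra (R : Type w) [CommRing R] (Q : Type u) [Quiver.{v} Q] : Type max u v w :=
  AnyPath Q →₀ R

namespace PathAlgebra

variable (R : Type w) [CommRing R] {Q : Type u} [Quiver.{v} Q]

instance : AddCommGroup (PathAlgebra R Q) := inferInstanceAs (AddCommGroup (AnyPath Q →₀ R))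

instance {S : Type*} [CommSemiring S] [Algebra S R] : Module S (PathAlgebra R Q) :=
  inferInstanceAs (Module S (AnyPath Q →₀ R))

instance {S : Type*} [CommSemiring S] [Algebra S R] : IsScalarTower S R (PathAlgebra R Q) :=
  inferInstanceAs (IsScalarTower S R (AnyPath Q →₀ R))

variable (Q) in
/-- The `R`-basis of the path algebra given by the paths. -/
def basis : Module.Basis (AnyPath Q) R (PathAlgebra R Q) :=
  Module.Basis.ofRepr (LinearEquiv.refl R (AnyPath Q →₀ R))

/-- A path as an element of the path algebra. -/
def ofPath (p : AnyPath Q) : PathAlgebra R Q := basis R Q p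

/-- The trivial path `e_x` as an element of the path algebra. -/
def vertex (x : Q) : PathAlgebra R Q := ofPath R ⟨x, x, Quiver.Path.nil⟩

open Classical in
/-- The product `p q` of two paths in the path algebra: the composite path if `t(p) = h(q)`, and
zero otherwise. -/
def pathMul (p q : AnyPath Q) : PathAlgebra R Q :=
  if h : p.1 = q.2.1 then ofPath R ⟨q.1, p.2.1, q.2.2.comp (p.2.2.cast h rfl)⟩ else 0

/-- The `R`-bilinear extension of the product of paths. -/
def mulHom : PathAlgebra R Q →ₗ[R] PathAlgebra R Q →ₗ[R] PathAlgebra R Q :=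
  (basis R Q).constr R fun p => (basis R Q).constr R fun q => pathMul R p q

instance : Mul (PathAlgebra R Q) := ⟨fun x y => mulHom R x y⟩

/-- The identity of the path algebra is the sum of the trivial paths. -/
instance [Fintype Q] : One (PathAlgebra R Q) := ⟨∑ x : Q, vertex R x⟩

variable {R}

theorem mul_def (x y : PathAlgebra R Q) : x * y = mulHom R x y := rfl

theorem ofPath_mul_ofPath (p q : AnyPath Q) :
    (ofPath R p * ofPath R q : PathAlgebra R Q) = pathMul R p q := by
  rw [mul_def, mulHom, ofPath, ofPath, Module.Basis.constr_basis, Module.Basis.constr_basis]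

theorem ofPath_mul_ofPath_comp {x y z : Q} (p : Quiver.Path y z) (q : Quiver.Path x y) :
    (ofPath R ⟨y, z, p⟩ * ofPath R ⟨x, y, q⟩ : PathAlgebra R Q) = ofPath R ⟨x, z, q.comp p⟩ := by
  rw [ofPath_mul_ofPath]
  simp [pathMul]

theorem ofPath_mul_ofPath_of_ne {p q : AnyPath Q} (h : p.1 ≠ q.2.1) :
    (ofPath R p * ofPath R q : PathAlgebra R Q) = 0 := by
  rw [ofPath_mul_ofPath]
  simp [pathMul, h]

theorem induction_on {P : PathAlgebra R Q → Prop} (x : PathAlgebra R Q) (zero : P 0)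
    (add : ∀ x y, P x → P y → P (x + y)) (smul : ∀ (r : R) p, P (r • ofPath R p)) : P x := by
  rw [← (basis R Q).linearCombination_repr x, Finsupp.linearCombination_apply]
  exact Finset.sum_induction _ P add zero fun p _ => smul _ p

theorem path_mul_assoc (p q r : AnyPath Q) :
    (ofPath R p * ofPath R q * ofPath R r : PathAlgebra R Q)
      = ofPath R p * (ofPath R q * ofPath R r) := by
  have zero_mul' (x : PathAlgebra R Q) : 0 * x = 0 := by simp [mul_def]
  have mul_zero' (x : PathAlgebra R Q) : x * 0 = 0 := by simp [mul_def]
  obtain ⟨a, b, p⟩ := p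
  obtain ⟨c, d, q⟩ := q
  obtain ⟨e, f, r⟩ := r
  by_cases h₁ : a = d
  · subst h₁
    by_cases h₂ : c = f
    · subst h₂
      simp only [ofPath_mul_ofPath_comp, Quiver.Path.comp_assoc]
    · rw [ofPath_mul_ofPath_of_ne (p := ⟨c, a, q⟩) h₂, ofPath_mul_ofPath_comp,
        ofPath_mul_ofPath_of_ne h₂, mul_zero']
  · rw [ofPath_mul_ofPath_of_ne (p := ⟨a, b, p⟩) h₁, zero_mul']
    by_cases h₂ : c = f
    · subst h₂
      rw [ofPath_mul_ofPath_comp, ofPath_mul_ofPath_of_ne h₁]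
    · rw [ofPath_mul_ofPath_of_ne (p := ⟨c, d, q⟩) h₂, mul_zero']

instance [Fintype Q] : Ring (PathAlgebra R Q) where
  __ := (inferInstance : AddCommGroup (PathAlgebra R Q))
  left_distrib x y z := by simp [mul_def]
  right_distrib x y z := by simp [mul_def]
  zero_mul x := by simp [mul_def]
  mul_zero x := by simp [mul_def]
  mul_assoc x y z := by
    induction x using induction_on with
    | zero => simp [mul_def]
    | add a b ha hb => simp only [mul_def, map_add, LinearMap.add_apply] at *; rw [ha, hb]
    | smul a p =>
      induction y using induction_on with
      | zero => simp [mul_def]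
      | add c d hc hd => simp only [mul_def, map_add, LinearMap.add_apply] at *; rw [hc, hd]
      | smul c q =>
        induction z using induction_on with
        | zero => simp [mul_def]
        | add c d hc hd => simp only [mul_def, map_add] at *; rw [hc, hd]
        | smul e r =>
          have h := path_mul_assoc (R := R) p q r
          simp only [mul_def, map_smul, LinearMap.smul_apply] at *
          rw [h]
  one_mul x := by
    classical
    induction x using induction_on with
    | zero => simp [mul_def]
    | add a b ha hb => simp only [mul_def, map_add] at *; rw [ha, hb]
    | smul a p =>
      obtain ⟨b, c, p⟩ := p
      rw [mul_def, map_smul, ← mul_def]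
      congr 1
      change (∑ x : Q, vertex R x) * _ = _
      rw [mul_def, map_sum, LinearMap.sum_apply, Finset.sum_eq_single c]
      · rw [← mul_def]; exact ofPath_mul_ofPath_comp _ _
      · intro d _ hd
        rw [← mul_def]; exact ofPath_mul_ofPath_of_ne hd
      · simp
  mul_one x := by
    classical
    induction x using induction_on with
    | zero => simp [mul_def]
    | add a b ha hb => simp only [mul_def, map_add, LinearMap.add_apply] at *; rw [ha, hb]
    | smul a p =>
      obtain ⟨b, c, p⟩ := p
      rw [mul_def, map_smul, LinearMap.smul_apply, ← mul_def]
      congr 1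
      change _ * (∑ x : Q, vertex R x) = _
      rw [mul_def, map_sum, Finset.sum_eq_single b]
      · rw [← mul_def]
        refine (ofPath_mul_ofPath_comp _ _).trans ?_
        rw [Quiver.Path.nil_comp]
      · intro d _ hd
        rw [← mul_def]; exact ofPath_mul_ofPath_of_ne (Ne.symm hd)
      · simp

instance [Fintype Q] {S : Type*} [CommSemiring S] [Algebra S R] : Algebra S (PathAlgebra R Q) :=
  Algebra.ofModule
    (fun s x y => by
      rw [← algebraMap_smul R s x, ← algebraMap_smul R s (x * y), mul_def, mul_def, map_smul,
        LinearMap.smul_apply])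
    (fun s x y => by
      rw [← algebraMap_smul R s y, ← algebraMap_smul R s (x * y), mul_def, mul_def, map_smul])

end PathAlgebra

/-! ### Completions -/

section Completion

variable (k : Type w) [CommRing k] {A : Type u} [Ring A] [Algebra k A]

/-- The completion of a (possibly non-commutative) `k`-algebra `A` in the `B`-adic topology, for a
two-sided ideal `B`: the inverse limit of the quotients `A / B ^ d`, as the subalgebra of compatible
families in their product. -/
def Completion (B : Ideal A) [B.IsTwoSided] : Subalgebra k (∀ d : ℕ, A ⧸ B ^ d) where
  carrier := {x | ∀ ⦃d d' : ℕ⦄ (h : d ≤ d'),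
    Ideal.Quotient.factorₐ k (Ideal.pow_le_pow_right (I := B) h) (x d') = x d}
  mul_mem' hx hy d d' h := by simp only [Pi.mul_apply, map_mul, hx h, hy h]
  add_mem' hx hy d d' h := by simp only [Pi.add_apply, map_add, hx h, hy h]
  algebraMap_mem' r d d' h := by simp only [Pi.algebraMap_apply, AlgHom.commutes]

/-- The closure of (the image of) a two-sided ideal `H` of `A` in the `B`-adic completion of `A`,
that is, `⋂_d (H + B ^ d)` formed in the completion: an element of the completion belongs to it iff
for each `d` it is congruent to an element of `H` modulo the kernel of the projection of the
completion to `A / B ^ d`. -/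
def closureIdeal (B H : Ideal A) [B.IsTwoSided] [H.IsTwoSided] : Ideal (Completion k B) where
  carrier := {x | ∀ d : ℕ, ∃ h ∈ H, x.1 d = Ideal.Quotient.mk (B ^ d) h}
  zero_mem' d := ⟨0, H.zero_mem, by simp⟩
  add_mem' {x y} hx hy d := by
    obtain ⟨a, ha, hxa⟩ := hx d
    obtain ⟨b, hb, hyb⟩ := hy d
    exact ⟨a + b, H.add_mem ha hb, by simp [hxa, hyb]⟩
  smul_mem' c x hx d := by
    obtain ⟨a, ha, hxa⟩ := hx d
    obtain ⟨b, hb⟩ := Ideal.Quotient.mk_surjective (c.1 d)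
    exact ⟨b * a, H.mul_mem_left b ha, by simp [hxa, hb]⟩

instance (B H : Ideal A) [B.IsTwoSided] [H.IsTwoSided] : (closureIdeal k B H).IsTwoSided where
  mul_mem_of_left {x} c hx d := by
    obtain ⟨a, ha, hxa⟩ := hx d
    obtain ⟨b, hb⟩ := Ideal.Quotient.mk_surjective (c.1 d)
    exact ⟨a * b, H.mul_mem_right b ha, by simp [hxa, hb]⟩

end Completion

/-! ### The two algebras -/

section Main

variable {Q : Type u} [Quiver.{v} Q] [Fintype Q]

/-- The two-sided ideal of `R Q` generated by the arrows. -/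
def arrowIdeal (R : Type w) [CommRing R] (Q : Type u) [Quiver.{v} Q] [Fintype Q] :
    TwoSidedIdeal (PathAlgebra R Q) :=
  TwoSidedIdeal.span {a | ∃ (x y : Q) (f : x ⟶ y), a = PathAlgebra.ofPath R ⟨x, y, f.toPath⟩}

/-- The two-sided ideal `⟨Z⟩` of `R Q` generated by a set `Z` of paths. -/
def relationIdeal (R : Type w) [CommRing R] (Z : Set (AnyPath Q)) :
    TwoSidedIdeal (PathAlgebra R Q) :=
  TwoSidedIdeal.span (PathAlgebra.ofPath R '' Z)

/-- The completed string algebra of `(Q, Z)` over `k`: the quotient of the completion of `k Q` in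
the arrow-adic topology by the closure of the ideal generated by `Z`. -/
abbrev CompletedStringAlgebra (k : Type w) [Field k] (Z : Set (AnyPath Q)) : Type max u v w :=
  Completion k (arrowIdeal k Q).asIdeal ⧸
    closureIdeal k (arrowIdeal k Q).asIdeal (relationIdeal k Z).asIdeal

/-- The element `σ_x` of `R Q`: the sum of the `Z`-primitive cycles at `x`. There are finitely many
of them when `Q` is finite and `(Q, Z)` is special. -/
def sigma (R : Type w) [CommRing R] (Z : Set (AnyPath Q)) (x : Q) : PathAlgebra R Q :=
  ∑ᶠ c ∈ {c : Quiver.Path x x | IsPrimitive Z c}, PathAlgebra.ofPath R ⟨x, x, c⟩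

/-- The ideal
`I = ⟨Z⟩ + ∑ i, (⟨s_i e_x - σ_x ∣ x ∈ V[i]⟩ + ⟨s_i e_x ∣ x ∈ Q₀ ∖ V[i]⟩)` of `R Q`. -/
def stringIdeal {R : Type w} [CommRing R] (Z : Set (AnyPath Q)) {n : ℕ}
    (e : Fin n ≃ NerveParts Z) (s : Fin n → R) : TwoSidedIdeal (PathAlgebra R Q) :=
  relationIdeal R Z ⊔ ⨆ i : Fin n,
    (TwoSidedIdeal.span {a | ∃ x ∈ part e i, a = s i • PathAlgebra.vertex R x - sigma R Z x} ⊔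
      TwoSidedIdeal.span {a | ∃ x ∉ part e i, a = s i • PathAlgebra.vertex R x})

end Main

end StringAlg

end

open Quiver

noncomputable section

namespace StringAlg

universe u v w

/-! Both algebras are quotients of algebras that map to the product over `d` of the truncations
`kQ/(⟨Z⟩ + B^d)`. The proof shows that the two maps have the same range, with kernels the closure of
`⟨Z⟩` and the ideal `I` respectively. Products of paths are written below in order of traversal.

Combinatorics. Since `(Q, Z)` is special, an admissible path is determined by its last arrow and its
length, so of two admissible paths with the same last arrow the shorter is a terminal part of the
longer. Hence at most one primitive cycle ends in a given arrow, and one does as soon as arbitrarily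
long admissible paths end in it. Consequently every admissible path is `q c^m` with `q` reduced and
`c` the primitive cycle with the last arrow of `q` (`m = 0` if there is none). Here `q` is unique,
and there are only finitely many reduced paths (`exists_isReduced`, `IsReduced.eq_of_extend_eq`,
`finite_setOf_isReduced`).

The map from `RQ`. The sum of the `σ_x` over `x ∈ V[i]` is central modulo `⟨Z⟩` and lies in `B`,
hence is nilpotent in each truncation. So `t_i` can be sent to it, and the resulting map kills `I`
(`exists_truncPiHom`).

Normal forms. Modulo `I`, the variable `t_i` acts on a non-trivial path by appending the primitive
cycle with the same last arrow if the head is in `V[i]` and such a cycle exists, and by zero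
otherwise. A family `a` of coefficients therefore gives a finite sum of power series times reduced
paths, `normalForm e hZ a`, and every element of `RQ` is congruent to such a sum
(`exists_normalForm`). It has the same image as the series `∑ a_p p` of the completion, which yields
equality of ranges. If that image is zero, then `a` vanishes on admissible paths and the normal form
itself is zero, which yields the kernel. -/

section Combinatorics

/-! ### Admissible paths, their periods and primitive cycles. -/

variable {Q : Type u} [Quiver.{v} Q]

/-- The last arrow of a path, if there is one. -/
def lastArrow {x : Q} : ∀ {y : Q}, Quiver.Path x y → Option (Quiver.Costar y)
  | _, .nil => none
  | _, .cons _ b => some ⟨_, b⟩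

@[simp] theorem lastArrow_nil (x : Q) : lastArrow (.nil : Quiver.Path x x) = none := rfl

@[simp] theorem lastArrow_cons {x y z : Q} (p : Quiver.Path x y) (b : y ⟶ z) :
    lastArrow (p.cons b) = some ⟨y, b⟩ := rfl

theorem lastArrow_comp {x y z : Q} (p : Quiver.Path x y) (q : Quiver.Path y z)
    (hq : 0 < q.length) : lastArrow (p.comp q) = lastArrow q := by
  cases q with
  | nil => simp at hq
  | cons q b => rfl

theorem length_pos_of_lastArrow_eq_some {x y : Q} {p : Quiver.Path x y} {b : Quiver.Costar y}
    (h : lastArrow p = some b) : 0 < p.length := by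
  cases p with
  | nil => simp at h
  | cons q b => simp

theorem exists_lastArrow_eq_some {x y : Q} {p : Quiver.Path x y} (h : 0 < p.length) :
    ∃ b, lastArrow p = some b := by
  cases p with
  | nil => simp at h
  | cons q b => exact ⟨_, rfl⟩

theorem length_pos_of_lastArrow_eq {x x' y : Q} {p : Quiver.Path x y} {p' : Quiver.Path x' y}
    (h : lastArrow p = lastArrow p') (hp : 0 < p.length) : 0 < p'.length := by
  obtain ⟨b, hb⟩ := exists_lastArrow_eq_some hp
  exact length_pos_of_lastArrow_eq_some (h ▸ hb)

theorem exists_eq_cons {x y : Q} {p : Quiver.Path x y} (h : 0 < p.length) :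
    ∃ (z : Q) (q : Quiver.Path x z) (b : z ⟶ y), p = q.cons b := by
  cases p with
  | nil => simp at h
  | cons q b => exact ⟨_, q, b, rfl⟩

theorem exists_eq_toPath_comp {x y : Q} {p : Quiver.Path x y} (h : 0 < p.length) :
    ∃ (z : Q) (a : x ⟶ z) (q : Quiver.Path z y), p = a.toPath.comp q := by
  obtain ⟨z, a, q, -, h⟩ := p.eq_toPath_comp_of_length_eq_succ
    (n := p.length - 1) (by omega)
  exact ⟨z, a, q, h⟩

theorem exists_eq_comp_length_right {x y : Q} (p : Quiver.Path x y) {n : ℕ} (h : n ≤ p.length) :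
    ∃ (z : Q) (q : Quiver.Path x z) (r : Quiver.Path z y), p = q.comp r ∧ r.length = n := by
  obtain ⟨z, q, r, h1, h2⟩ := p.exists_eq_comp_of_le_length (n := p.length - n) (by omega)
  refine ⟨z, q, r, h1, ?_⟩
  have := congrArg Quiver.Path.length h1
  rw [Quiver.Path.length_comp] at this
  omega

/-- The middle vertices are not known to agree in advance, hence the equality of triples, which can
be eliminated by `cases`. -/
theorem comp_eq_comp_of_length_eq {x z y : Q} (p : Quiver.Path x z) (q : Quiver.Path z y) {z' : Q}
    (p' : Quiver.Path x z') (q' : Quiver.Path z' y) (h : p.comp q = p'.comp q')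
    (hl : q.length = q'.length) :
    (⟨z, p, q⟩ : Σ z : Q, Quiver.Path x z × Quiver.Path z y) = ⟨z', p', q'⟩ := by
  induction q with
  | nil =>
    cases q' with
    | nil => simp_all
    | cons => simp at hl
  | cons q b ih =>
    cases q' with
    | nil => simp at hl
    | cons q' b' =>
      simp only [Quiver.Path.comp_cons, Quiver.Path.cons.injEq] at h
      obtain ⟨rfl, h, h'⟩ := h
      have := ih q' (eq_of_heq h) (by simpa using hl)
      cases this
      cases h'
      rfl

/-! ### Powers -/

@[simp] theorem pathPow_zero {x : Q} (c : Quiver.Path x x) : pathPow c 0 = .nil := rfl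

theorem pathPow_succ {x : Q} (c : Quiver.Path x x) (m : ℕ) :
    pathPow c (m + 1) = (pathPow c m).comp c := rfl

@[simp] theorem pathPow_one {x : Q} (c : Quiver.Path x x) : pathPow c 1 = c := by
  simp [pathPow_succ]

theorem pathPow_add {x : Q} (c : Quiver.Path x x) (m n : ℕ) :
    pathPow c (m + n) = (pathPow c m).comp (pathPow c n) := by
  induction n with
  | zero => rfl
  | succ n ih => rw [← add_assoc, pathPow_succ, ih, pathPow_succ, Quiver.Path.comp_assoc]

theorem pathPow_succ' {x : Q} (c : Quiver.Path x x) (m : ℕ) :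
    pathPow c (m + 1) = c.comp (pathPow c m) := by
  rw [add_comm, pathPow_add, pathPow_one]

theorem pathPow_mul {x : Q} (c : Quiver.Path x x) (m n : ℕ) :
    pathPow c (m * n) = pathPow (pathPow c m) n := by
  induction n with
  | zero => rfl
  | succ n ih => rw [mul_add, mul_one, pathPow_add, ih, pathPow_succ]

@[simp] theorem length_pathPow {x : Q} (c : Quiver.Path x x) (m : ℕ) :
    (pathPow c m).length = m * c.length := by
  induction m with
  | zero => simp
  | succ m ih => rw [pathPow_succ, Quiver.Path.length_comp, ih]; ring

theorem lastArrow_pathPow {x : Q} (c : Quiver.Path x x) {m : ℕ} (hm : m ≠ 0) :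
    lastArrow (pathPow c m) = lastArrow c := by
  obtain ⟨m, rfl⟩ := Nat.exists_eq_succ_of_ne_zero hm
  rcases Nat.eq_zero_or_pos c.length with h | h
  · rw [Quiver.Path.eq_nil_of_length_zero c h, Quiver.Path.eq_nil_of_length_zero (pathPow _ _)]
    simp
  · exact lastArrow_comp _ _ h

/-- The conjugation identity behind the rotation of cycles. -/
theorem toPath_comp_pathPow {x y : Q} (a : x ⟶ y) (c : Quiver.Path y x) (m : ℕ) :
    a.toPath.comp (pathPow (c.cons a) m) = (pathPow (a.toPath.comp c) m).comp a.toPath := by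
  induction m with
  | zero => rw [pathPow_zero, pathPow_zero, Quiver.Path.comp_nil, Quiver.Path.nil_comp]
  | succ m ih =>
    rw [pathPow_succ, ← Quiver.Path.comp_assoc, ih, pathPow_succ, ← Quiver.Path.comp_toPath_eq_cons]
    simp only [Quiver.Path.comp_assoc]

/-! ### Admissible paths -/

variable {Z : Set (AnyPath Q)}

theorem IsAdmissible.of_comp {x y z w : Q} {p : Quiver.Path x y} {q : Quiver.Path y z}
    {r : Quiver.Path z w} (h : IsAdmissible Z ((p.comp q).comp r)) : IsAdmissible Z q := by
  rintro x' y' q' s r' rfl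
  exact h x' y' (p.comp q') s (r'.comp r) (by simp [Quiver.Path.comp_assoc])

theorem IsAdmissible.of_comp_left {x y z : Q} {p : Quiver.Path x y} {q : Quiver.Path y z}
    (h : IsAdmissible Z (p.comp q)) : IsAdmissible Z p :=
  IsAdmissible.of_comp (p := .nil) (r := q) (by simpa using h)

theorem IsAdmissible.of_comp_right {x y z : Q} {p : Quiver.Path x y} {q : Quiver.Path y z}
    (h : IsAdmissible Z (p.comp q)) : IsAdmissible Z q :=
  IsAdmissible.of_comp (p := p) (r := .nil) (by simpa using h)

theorem IsAdmissible.twoPath_notMem {x y z t s : Q} {p : Quiver.Path x y} {c : y ⟶ z} {b : z ⟶ t}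
    {q : Quiver.Path t s} (h : IsAdmissible Z ((p.cons c).comp (b.toPath.comp q))) :
    twoPath b c ∉ Z :=
  h _ _ p _ q (by
    rw [← Quiver.Path.comp_toPath_eq_cons]
    simp only [Quiver.Path.comp_assoc])

/-- The first arrow of `q` admits only one arrow before it outside the relations: this is the second
half of specialness. -/
theorem lastArrow_eq_of_admissible_comp (hZ : IsSpecial Z) {x x' y z : Q} {p : Quiver.Path x y}
    {p' : Quiver.Path x' y} {q : Quiver.Path y z} (h : IsAdmissible Z (p.comp q))
    (h' : IsAdmissible Z (p'.comp q)) (hp : 0 < p.length) (hp' : 0 < p'.length)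
    (hq : 0 < q.length) : lastArrow p = lastArrow p' := by
  obtain ⟨_, p, b, rfl⟩ := exists_eq_cons hp
  obtain ⟨_, p', b', rfl⟩ := exists_eq_cons hp'
  obtain ⟨_, a, q, rfl⟩ := exists_eq_toPath_comp hq
  have := @hZ.2 _ _ a ⟨_, b⟩ h.twoPath_notMem ⟨_, b'⟩ h'.twoPath_notMem
  simpa using this

/-- In a special pair an admissible path is determined by its length and its last arrow. -/
theorem IsAdmissible.eq_of_lastArrow_eq (hZ : IsSpecial Z) {x y : Q} {p : Quiver.Path x y} {x' : Q}
    {p' : Quiver.Path x' y} (h : IsAdmissible Z p) (h' : IsAdmissible Z p')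
    (hl : lastArrow p = lastArrow p') (hn : p.length = p'.length) :
    (⟨x, p⟩ : Σ x : Q, Quiver.Path x y) = ⟨x', p'⟩ := by
  induction p with
  | nil =>
    cases p' with
    | nil => rfl
    | cons => simp at hn
  | cons p b ih =>
    cases p' with
    | nil => simp at hn
    | cons p' b' =>
      simp only [lastArrow_cons, Option.some.injEq] at hl
      cases hl
      simp only [Quiver.Path.length_cons, add_left_inj] at hn
      have hpp : lastArrow p = lastArrow p' := by
        rcases Nat.eq_zero_or_pos p.length with h0 | h0
        · cases p with
          | cons => simp at h0
          | nil =>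
            cases p' with
            | cons => simp at hn
            | nil => rfl
        · exact lastArrow_eq_of_admissible_comp hZ (q := b.toPath) h h' h0 (hn ▸ h0) (by simp)
      cases ih (h.of_comp_left (q := b.toPath)) (h'.of_comp_left (q := b.toPath)) hpp hn
      rfl

theorem IsAdmissible.exists_eq_comp (hZ : IsSpecial Z) {x y : Q} {p : Quiver.Path x y} {x' : Q}
    {p' : Quiver.Path x' y} (h : IsAdmissible Z p) (h' : IsAdmissible Z p')
    (hl : lastArrow p = lastArrow p') (hn : p.length ≤ p'.length) :
    ∃ r : Quiver.Path x' x, p' = r.comp p := by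
  rcases Nat.eq_zero_or_pos p'.length with h0 | h0
  · cases p' with
    | cons => simp at h0
    | nil =>
      cases p with
      | nil => exact ⟨.nil, rfl⟩
      | cons => simp at hn
  obtain ⟨z, q, r, rfl, hr⟩ := exists_eq_comp_length_right p' hn
  have hr0 : 0 < r.length := hr ▸ length_pos_of_lastArrow_eq hl.symm h0
  cases h.eq_of_lastArrow_eq hZ h'.of_comp_right (hl.trans (lastArrow_comp _ _ hr0)) hr.symm
  exact ⟨q, rfl⟩

/-! ### Periods -/

/-- A cycle all of whose powers are admissible. -/
def IsPeriod (Z : Set (AnyPath Q)) {x : Q} (c : Quiver.Path x x) : Prop :=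
  0 < c.length ∧ ∀ m : ℕ, 1 ≤ m → IsAdmissible Z (pathPow c m)

theorem IsPrimitive.isPeriod {x : Q} {c : Quiver.Path x x} (h : IsPrimitive Z c) : IsPeriod Z c :=
  ⟨h.1, h.2.1⟩

theorem IsPeriod.admissible {x : Q} {c : Quiver.Path x x} (h : IsPeriod Z c) : IsAdmissible Z c := by
  simpa using h.2 1 le_rfl

theorem IsPeriod.admissible_comp_self {x : Q} {c : Quiver.Path x x} (h : IsPeriod Z c) :
    IsAdmissible Z (c.comp c) := by
  simpa [pathPow_succ] using h.2 2 (by norm_num)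

/-- A high power of `c` ends in `p`, so the next power ends in `p c`. The exponent `p.length + 1` is
large enough and never zero. -/
theorem IsPeriod.admissible_comp (hZ : IsSpecial Z) {x y : Q} {p : Quiver.Path x y}
    {c : Quiver.Path y y} (hc : IsPeriod Z c) (hp : IsAdmissible Z p)
    (hl : lastArrow p = lastArrow c) : IsAdmissible Z (p.comp c) := by
  have h1 := hc.1
  obtain ⟨r, hr⟩ := hp.exists_eq_comp hZ (hc.2 (p.length + 1) (by omega))
    (by rw [lastArrow_pathPow _ (by omega), hl]) (by rw [length_pathPow]; nlinarith)
  have := hc.2 (p.length + 1 + 1) (by omega)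
  rw [pathPow_succ, hr, Quiver.Path.comp_assoc] at this
  exact this.of_comp_right

theorem lastArrow_comp_pathPow {x y : Q} {p : Quiver.Path x y}
    {c : Quiver.Path y y} (hl : lastArrow p = lastArrow c) (m : ℕ) :
    lastArrow (p.comp (pathPow c m)) = lastArrow p := by
  induction m with
  | zero => simp
  | succ m ih =>
    rcases Nat.eq_zero_or_pos c.length with h | h
    · rw [Quiver.Path.eq_nil_of_length_zero (pathPow _ _) (by simp [h])]; simp
    · rw [pathPow_succ, ← Quiver.Path.comp_assoc, lastArrow_comp _ _ h, hl]

theorem IsPeriod.admissible_comp_pathPow (hZ : IsSpecial Z) {x y : Q} {p : Quiver.Path x y}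
    {c : Quiver.Path y y} (hc : IsPeriod Z c) (hp : IsAdmissible Z p)
    (hl : lastArrow p = lastArrow c) (m : ℕ) : IsAdmissible Z (p.comp (pathPow c m)) := by
  induction m with
  | zero => simpa
  | succ m ih =>
    rw [pathPow_succ, ← Quiver.Path.comp_assoc]
    exact hc.admissible_comp hZ ih (by rw [lastArrow_comp_pathPow hl, hl])

/-- The arrow preceding `c` in `p c` must be the one preceding the second `c` in the admissible path
`c c`. -/
theorem IsPeriod.lastArrow_eq (hZ : IsSpecial Z) {x y : Q} {p : Quiver.Path x y}
    {c : Quiver.Path y y} (hc : IsPeriod Z c) (h : IsAdmissible Z (p.comp c)) (hp : 0 < p.length) :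
    lastArrow p = lastArrow c :=
  lastArrow_eq_of_admissible_comp hZ h hc.admissible_comp_self hp hc.1 hc.1

/-- Euclid's algorithm on lengths: the shorter cycle `c` is a terminal part of `d = r c`, the
remainder `r` is again a period with the same last arrow, and the pair `r`, `c` has smaller total
length. -/
theorem IsPeriod.exists_common_root (hZ : IsSpecial Z) {y : Q} (N : ℕ) {c d : Quiver.Path y y}
    (hN : c.length + d.length ≤ N) (hc : IsPeriod Z c) (hd : IsPeriod Z d)
    (hl : lastArrow c = lastArrow d) :
    ∃ (r : Quiver.Path y y) (i j : ℕ), c = pathPow r i ∧ d = pathPow r j := by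
  induction N generalizing c d with
  | zero => have := hc.1; omega
  | succ N ih =>
    wlog hcd : c.length ≤ d.length generalizing c d
    · obtain ⟨r, i, j, h1, h2⟩ := this (by omega) hd hc hl.symm (by omega)
      exact ⟨r, j, i, h2, h1⟩
    obtain ⟨r, rfl⟩ := hc.admissible.exists_eq_comp hZ hd.admissible hl hcd
    have hc1 := hc.1
    rcases Nat.eq_zero_or_pos r.length with h0 | h0
    · rw [Quiver.Path.eq_nil_of_length_zero r h0]
      exact ⟨c, 1, 1, by simp, by simp⟩
    have hrl : lastArrow r = lastArrow c := hc.lastArrow_eq hZ hd.admissible h0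
    -- If `r^m` is admissible then so is `r^m d = r^(m+1) c`, because `d` is a period with the same
    -- last arrow.
    have key : ∀ m : ℕ, 1 ≤ m →
        IsAdmissible Z (pathPow r m) ∧ lastArrow (pathPow r m) = lastArrow c := by
      intro m hm
      induction m, hm using Nat.le_induction with
      | base => simpa [hrl] using hd.admissible.of_comp_left
      | succ m hm ihm =>
        refine ⟨?_, by rw [lastArrow_pathPow _ (by omega), hrl]⟩
        have := hd.admissible_comp hZ ihm.1 (ihm.2.trans hl)
        rw [← Quiver.Path.comp_assoc] at this
        exact this.of_comp_left
    rw [Quiver.Path.length_comp] at hN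
    obtain ⟨s, i, j, h1, h2⟩ := ih (c := r) (d := c) (by omega) ⟨h0, fun m hm => (key m hm).1⟩ hc hrl
    refine ⟨s, j, i + j, h2, ?_⟩
    rw [pathPow_add, ← h1, ← h2]

theorem IsPrimitive.eq_of_eq_pathPow {y : Q} {c r : Quiver.Path y y} (hc : IsPrimitive Z c) {i : ℕ}
    (h : c = pathPow r i) : c = r := by
  have hl := congrArg Quiver.Path.length h
  rw [length_pathPow] at hl
  have hc1 := hc.1
  have hr : 0 < r.length := Nat.pos_of_ne_zero fun h0 => by rw [h0, mul_zero] at hl; omega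
  have h2 : ¬ r.length < c.length := fun hlt => hc.2.2 r hr hlt i h
  have : i = 1 := by
    rcases i with _ | _ | i
    · rw [zero_mul] at hl; omega
    · rfl
    · exfalso; nlinarith
  rw [h, this, pathPow_one]

/-- A primitive cycle is determined by its last arrow. -/
theorem IsPrimitive.eq_of_lastArrow_eq (hZ : IsSpecial Z) {y : Q} {c d : Quiver.Path y y}
    (hc : IsPrimitive Z c) (hd : IsPrimitive Z d) (hl : lastArrow c = lastArrow d) : c = d := by
  obtain ⟨r, i, j, h1, h2⟩ :=
    IsPeriod.exists_common_root hZ _ le_rfl hc.isPeriod hd.isPeriod hl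
  rw [hc.eq_of_eq_pathPow h1, hd.eq_of_eq_pathPow h2]

/-- Descent on the length: if `c = d^m` with `d` shorter, then `d^k` is an initial part of `c^k`, so
`d` is a period too. -/
theorem IsPeriod.exists_isPrimitive {y : Q} {c : Quiver.Path y y}
    (hc : IsPeriod Z c) : ∃ d : Quiver.Path y y, IsPrimitive Z d ∧ lastArrow d = lastArrow c := by
  induction hN : c.length using Nat.strong_induction_on generalizing c with
  | _ N ih =>
    by_cases hp : IsPrimitive Z c
    · exact ⟨c, hp, rfl⟩
    have : ∃ d : Quiver.Path y y, 0 < d.length ∧ d.length < c.length ∧ ∃ m : ℕ, c = pathPow d m := by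
      by_contra hcon
      push Not at hcon
      exact hp ⟨hc.1, hc.2, hcon⟩
    obtain ⟨d, hd0, hdc, m, rfl⟩ := this
    have hm : m ≠ 0 := by rintro rfl; simp at hdc
    have hd : IsPeriod Z d := by
      refine ⟨hd0, fun k hk => ?_⟩
      have := hc.2 k hk
      rw [← pathPow_mul] at this
      have hmk : m * k = k + (m * k - k) := by
        have : 1 * k ≤ m * k := Nat.mul_le_mul_right k (Nat.one_le_iff_ne_zero.mpr hm)
        omega
      rw [hmk, pathPow_add] at this
      exact this.of_comp_left
    obtain ⟨e, he, hl⟩ := ih d.length (hN ▸ hdc) hd rfl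
    exact ⟨e, he, by rw [hl, lastArrow_pathPow _ hm]⟩

/-- Rotating a primitive cycle gives a primitive cycle. -/
theorem IsPrimitive.rotate {x y : Q} {a : x ⟶ y} {c : Quiver.Path y x}
    (h : IsPrimitive Z (c.cons a)) : IsPrimitive Z (a.toPath.comp c) := by
  refine ⟨by simp [Quiver.Path.length_comp], fun m _ => ?_, fun d hd0 hdl m hm => ?_⟩
  · have h1 := h.2.1 (m + 1) (by omega)
    -- The power of the rotated cycle sits inside the next power of the original one: `(c a)^(m+1) =
    -- c (a c)^m a`.
    have h2 : pathPow (c.cons a) (m + 1)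
        = c.comp ((pathPow (a.toPath.comp c) m).comp a.toPath) := by
      rw [pathPow_succ', ← toPath_comp_pathPow, ← Quiver.Path.comp_assoc]
      rfl
    rw [h2] at h1
    exact h1.of_comp_right.of_comp_left
  · obtain ⟨z, a', d, rfl⟩ := exists_eq_toPath_comp hd0
    have hm0 : m ≠ 0 := by
      rintro rfl
      simpa [Quiver.Path.length_comp] using congrArg Quiver.Path.length hm
    obtain ⟨m, rfl⟩ := Nat.exists_eq_succ_of_ne_zero hm0
    have hm' := hm
    have hlen := congrArg Quiver.Path.length hm
    rw [Nat.succ_eq_add_one, pathPow_succ', Quiver.Path.comp_assoc] at hm'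
    -- Comparing first arrows identifies `a'` with `a`, so the root `a d` can be rotated back to `d
    -- a`, a shorter root of `c a`.
    have hs := comp_eq_comp_of_length_eq _ _ _ _ hm' (by
      have := congrArg Quiver.Path.length hm'
      simpa [Quiver.Path.length_comp] using this)
    cases hs
    refine h.2.2 (d.cons a) (by simp) ?_ (m + 1) ?_
    · simp only [Quiver.Path.length_comp, Quiver.Path.length_toPath, Quiver.Path.length_cons]
        at hdl ⊢
      omega
    · apply Quiver.Path.comp_injective_right a.toPath
      rw [toPath_comp_pathPow]
      have := congrArg (fun p => p.comp a.toPath) hm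
      rw [Quiver.Path.comp_assoc] at this
      exact this

end Combinatorics

/-! ### Long admissible paths and the decomposition into a reduced path and a power of a cycle. -/

section Reduced

variable {Q : Type u} [Quiver.{v} Q] {Z : Set (AnyPath Q)}

/-! ### Existence of periods -/

/-- By induction `b c^m` is admissible: a long admissible path ending in `b` has the form `r b c^m`,
and its part `r b`, again ending in `b`, must end in `b c`; so `b c^(m+1)` occurs in it. -/
theorem isPeriod_of_admissible_toPath_comp (hZ : IsSpecial Z) {x y : Q} {b : x ⟶ y}
    (h : ∀ n : ℕ, ∃ (z : Q) (p : Quiver.Path z y),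
      IsAdmissible Z p ∧ lastArrow p = some ⟨x, b⟩ ∧ n ≤ p.length)
    {c : Quiver.Path y y} (hc : IsAdmissible Z (b.toPath.comp c))
    (hl : lastArrow c = some ⟨x, b⟩) : IsPeriod Z c := by
  have hc0 := length_pos_of_lastArrow_eq_some hl
  -- The leading `b` gives the right last arrow even for `m = 0`.
  suffices hb : ∀ m, IsAdmissible Z (b.toPath.comp (pathPow c m)) from
    ⟨hc0, fun m _ => (hb m).of_comp_right⟩
  intro m
  induction m with
  | zero => exact hc.of_comp_left
  | succ m ih =>
    have hlast : lastArrow (b.toPath.comp (pathPow c m)) = some ⟨x, b⟩ :=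
      lastArrow_comp_pathPow (by rw [hl]; rfl) m
    obtain ⟨z, p, hp, hpl, hpn⟩ := h (1 + (m + 1) * c.length)
    obtain ⟨r, rfl⟩ := ih.exists_eq_comp hZ hp (hlast.trans hpl.symm) (by
      rw [Quiver.Path.length_comp, Quiver.Path.length_toPath, length_pathPow]
      have : m * c.length ≤ (m + 1) * c.length := Nat.mul_le_mul_right _ (by omega)
      omega)
    have hr : IsAdmissible Z (r.comp b.toPath) := by
      rw [← Quiver.Path.comp_assoc] at hp
      exact hp.of_comp_left
    obtain ⟨s, hs⟩ := hc.exists_eq_comp hZ hr (by rw [lastArrow_comp _ _ hc0, hl]; rfl) (by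
      simp only [Quiver.Path.length_comp, Quiver.Path.length_toPath, length_pathPow] at hpn ⊢
      have : (m + 1) * c.length = m * c.length + c.length := by ring
      omega)
    rw [← Quiver.Path.comp_assoc, hs, Quiver.Path.comp_assoc, Quiver.Path.comp_assoc,
      ← pathPow_succ'] at hp
    exact hp.of_comp_right

/-- The first half of specialness makes the path determined forwards by its first arrow, so the
shorter path is an initial part of the longer one. Where the shorter ends, with `b`, the longer
continues by a cycle that again ends in `b`. -/
theorem exists_admissible_toPath_comp (hZ : IsSpecial Z) {x y : Q} {b : x ⟶ y} (N : ℕ) {z w : Q}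
    (a : z ⟶ w) (s s' : Quiver.Path w y) (hN : s.length = N) (hlt : s.length < s'.length)
    (hs : IsAdmissible Z (a.toPath.comp s)) (hs' : IsAdmissible Z (a.toPath.comp s'))
    (hl : lastArrow (a.toPath.comp s) = some ⟨x, b⟩)
    (hl' : lastArrow (a.toPath.comp s') = some ⟨x, b⟩) :
    ∃ c : Quiver.Path y y, IsAdmissible Z (b.toPath.comp c) ∧ lastArrow c = some ⟨x, b⟩ := by
  induction N generalizing z w with
  | zero =>
    cases s with
    | cons => simp at hN
    | nil =>
      rw [lastArrow_comp _ _ hlt] at hl'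
      rw [Quiver.Path.comp_nil] at hl
      cases hl
      exact ⟨s', hs', hl'⟩
  | succ N ih =>
    obtain ⟨_, a₁, s, rfl⟩ := exists_eq_toPath_comp (p := s) (by omega)
    obtain ⟨_, a₂, s', rfl⟩ := exists_eq_toPath_comp (p := s') (by omega)
    have h1 : IsAdmissible Z ((Quiver.Path.nil.cons a).comp (a₁.toPath.comp s)) := hs
    have h2 : IsAdmissible Z ((Quiver.Path.nil.cons a).comp (a₂.toPath.comp s')) := hs'
    cases @hZ.1 _ _ a ⟨_, a₁⟩ h1.twoPath_notMem ⟨_, a₂⟩ h2.twoPath_notMem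
    simp only [Quiver.Path.length_comp, Quiver.Path.length_toPath] at hN hlt
    rw [lastArrow_comp _ _ (by simp [Quiver.Path.length_comp])] at hl hl'
    exact ih a₁ s s' (by omega) (by omega) hs.of_comp_right hs'.of_comp_right hl hl'

/-- If there are arbitrarily long admissible paths with a given last arrow, then there is a
primitive cycle with that last arrow. -/
theorem exists_isPrimitive_lastArrow_eq [Finite Q] [∀ x y : Q, Finite (x ⟶ y)] (hZ : IsSpecial Z)
    {x y : Q} {b : x ⟶ y}
    (h : ∀ n : ℕ, ∃ (z : Q) (p : Quiver.Path z y),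
      IsAdmissible Z p ∧ lastArrow p = some ⟨x, b⟩ ∧ n ≤ p.length) :
    ∃ c : Quiver.Path y y, IsPrimitive Z c ∧ lastArrow c = some ⟨x, b⟩ := by
  -- Pigeonhole: record the first arrow of an admissible terminal part of length `n + 1`. There are
  -- finitely many arrows, so two different lengths share one.
  have h' : ∀ n : ℕ, ∃ (a : Σ z w : Q, z ⟶ w) (s : Quiver.Path a.2.1 y), s.length = n ∧
      IsAdmissible Z (a.2.2.toPath.comp s) ∧
      lastArrow (a.2.2.toPath.comp s) = some ⟨x, b⟩ := by
    intro n
    obtain ⟨z, p, hp, hpl, hpn⟩ := h (n + 1)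
    obtain ⟨w, q, r, rfl, hr⟩ := exists_eq_comp_length_right p hpn
    obtain ⟨t, a, s, rfl⟩ := exists_eq_toPath_comp (p := r) (by omega)
    rw [lastArrow_comp _ _ (by omega)] at hpl
    rw [Quiver.Path.length_comp, Quiver.Path.length_toPath] at hr
    exact ⟨⟨w, t, a⟩, s, by simp only; omega, hp.of_comp_right, hpl⟩
  choose a s hs ha hal using h'
  obtain ⟨m, n, hmn, heq⟩ : ∃ m n, m < n ∧ a m = a n := by
    obtain ⟨m, n, hmn, heq⟩ := Finite.exists_ne_map_eq_of_infinite a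
    rcases lt_or_gt_of_ne hmn with hlt | hlt
    exacts [⟨m, n, hlt, heq⟩, ⟨n, m, hlt, heq.symm⟩]
  obtain ⟨c, hc, hcl⟩ : ∃ c : Quiver.Path y y,
      IsAdmissible Z (b.toPath.comp c) ∧ lastArrow c = some ⟨x, b⟩ := by
    have aux : ∀ a', a m = a' → ∀ s' : Quiver.Path a'.2.1 y, s'.length = n →
        IsAdmissible Z (a'.2.2.toPath.comp s') →
        lastArrow (a'.2.2.toPath.comp s') = some ⟨x, b⟩ → ∃ c : Quiver.Path y y,
          IsAdmissible Z (b.toPath.comp c) ∧ lastArrow c = some ⟨x, b⟩ := by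
      rintro _ rfl s' hn hs' hl'
      exact exists_admissible_toPath_comp hZ m _ (s m) s' (hs m) (by rw [hs m, hn]; exact hmn)
        (ha m) hs' (hal m) hl'
    exact aux _ heq (s n) (hs n) (ha n) (hal n)
  obtain ⟨d, hd, hdl⟩ := (isPeriod_of_admissible_toPath_comp hZ h hc hcl).exists_isPrimitive
  exact ⟨d, hd, hdl.trans hcl⟩

theorem finite_setOf_length_eq [Finite Q] [∀ x y : Q, Finite (x ⟶ y)] (n : ℕ) :
    {p : AnyPath Q | p.2.2.length = n}.Finite := by
  induction n with
  | zero =>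
    refine (Set.finite_range fun x : Q => (⟨x, x, .nil⟩ : AnyPath Q)).subset ?_
    rintro ⟨x, y, p⟩ hp
    cases p with
    | nil => exact ⟨x, rfl⟩
    | cons => simp at hp
  | succ n ih =>
    refine (ih.biUnion fun p _ => Set.finite_range fun b : Quiver.Star p.2.1 =>
      (⟨p.1, b.1, p.2.2.cons b.2⟩ : AnyPath Q)).subset ?_
    rintro ⟨x, y, p⟩ hp
    cases p with
    | nil => simp at hp
    | @cons z _ p b =>
      simp only [Set.mem_iUnion]
      exact ⟨⟨x, z, p⟩, by simpa using hp, ⟨y, b⟩, rfl⟩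

theorem finite_setOf_length_lt [Finite Q] [∀ x y : Q, Finite (x ⟶ y)] (n : ℕ) :
    {p : AnyPath Q | p.2.2.length < n}.Finite := by
  refine ((Set.finite_lt_nat n).biUnion fun i _ => finite_setOf_length_eq (Q := Q) i).subset ?_
  intro p hp
  simpa using hp

/-! ### Reduced paths -/

/-- An admissible path is reduced if it is not a non-trivial path followed by a primitive cycle. -/
def IsReduced (Z : Set (AnyPath Q)) (p : AnyPath Q) : Prop :=
  IsAdmissible Z p.2.2 ∧ ∀ (q : Quiver.Path p.1 p.2.1) (c : Quiver.Path p.2.1 p.2.1),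
    0 < q.length → IsPrimitive Z c → p.2.2 ≠ q.comp c

theorem isReduced_nil (hlen : ∀ p ∈ Z, 2 ≤ p.2.2.length) (x : Q) :
    IsReduced Z ⟨x, x, .nil⟩ := by
  refine ⟨?_, ?_⟩
  · intro x' y' q z r h hz
    have h1 := congrArg Quiver.Path.length h
    have h2 := hlen _ hz
    simp only [Quiver.Path.length_comp, Quiver.Path.length_nil] at h1 h2
    omega
  · intro q c hq hc h
    have h1 := congrArg Quiver.Path.length h
    simp only [Quiver.Path.length_comp, Quiver.Path.length_nil] at h1
    omega

/-- For each last arrow the length is bounded. Either all admissible paths with that last arrow are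
bounded in length, or a primitive cycle `c` ends in it, and then any longer admissible path is a
non-trivial path followed by `c`. -/
theorem finite_setOf_isReduced [Finite Q] [∀ x y : Q, Finite (x ⟶ y)] (hZ : IsSpecial Z) :
    {p : AnyPath Q | IsReduced Z p}.Finite := by
  have key : ∀ b : Σ y : Q, Quiver.Costar y, ∃ N : ℕ, ∀ (x : Q) (p : Quiver.Path x b.1),
      IsReduced Z ⟨x, b.1, p⟩ → lastArrow p = some b.2 → p.length < N := by
    rintro ⟨y, z, b⟩
    by_cases h : ∀ n : ℕ, ∃ (x : Q) (p : Quiver.Path x y),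
      IsAdmissible Z p ∧ lastArrow p = some ⟨z, b⟩ ∧ n ≤ p.length
    · obtain ⟨c, hc, hcl⟩ := exists_isPrimitive_lastArrow_eq hZ h
      refine ⟨c.length + 1, fun x p hp hpl => ?_⟩
      by_contra! hlt
      obtain ⟨r, hr⟩ :=
        hc.isPeriod.admissible.exists_eq_comp hZ hp.1 (hcl.trans hpl.symm) (by simp only; omega)
      refine hp.2 r c ?_ hc hr
      have := congrArg Quiver.Path.length hr
      simp only [Quiver.Path.length_comp] at this
      omega
    · push Not at h
      obtain ⟨n, hn⟩ := h
      exact ⟨n, fun x p hp hpl => hn x p hp.1 hpl⟩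
  choose N hN using key
  refine ((finite_setOf_length_eq (Q := Q) 0).union
    (Set.finite_iUnion fun b => finite_setOf_length_lt (Q := Q) (N b))).subset ?_
  rintro ⟨x, y, p⟩ hp
  rcases Nat.eq_zero_or_pos p.length with h0 | h0
  · exact Or.inl h0
  · obtain ⟨b, hb⟩ := exists_lastArrow_eq_some h0
    exact Or.inr (Set.mem_iUnion.mpr ⟨⟨y, b⟩, hN ⟨y, b⟩ x p hp hb⟩)

/-- A path is periodic if its last arrow is the last arrow of a primitive cycle. -/
def IsPeriodic (Z : Set (AnyPath Q)) (p : AnyPath Q) : Prop :=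
  ∃ c : Quiver.Path p.2.1 p.2.1, IsPrimitive Z c ∧ lastArrow p.2.2 = lastArrow c

open Classical in
/-- The primitive cycle with the same last arrow as `p`, or the trivial path if there is none. -/
def cycleOf (Z : Set (AnyPath Q)) (p : AnyPath Q) : Quiver.Path p.2.1 p.2.1 :=
  if h : IsPeriodic Z p then h.choose else .nil

/-- The path `p` followed by the `m`-th power of `cycleOf Z p`. -/
def extend (Z : Set (AnyPath Q)) (p : AnyPath Q) (m : ℕ) : AnyPath Q :=
  ⟨p.1, p.2.1, p.2.2.comp (pathPow (cycleOf Z p) m)⟩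

@[simp] theorem extend_zero (p : AnyPath Q) : extend Z p 0 = p := rfl

theorem IsPeriodic.isPrimitive {p : AnyPath Q} (h : IsPeriodic Z p) :
    IsPrimitive Z (cycleOf Z p) := by
  rw [cycleOf, dif_pos h]
  exact h.choose_spec.1

theorem IsPeriodic.lastArrow_eq {p : AnyPath Q} (h : IsPeriodic Z p) :
    lastArrow p.2.2 = lastArrow (cycleOf Z p) := by
  rw [cycleOf, dif_pos h]
  exact h.choose_spec.2

theorem IsPeriodic.eq_cycleOf (hZ : IsSpecial Z) {p : AnyPath Q} {c : Quiver.Path p.2.1 p.2.1}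
    (hc : IsPrimitive Z c) (hl : lastArrow p.2.2 = lastArrow c) : cycleOf Z p = c := by
  have h : IsPeriodic Z p := ⟨c, hc, hl⟩
  exact h.isPrimitive.eq_of_lastArrow_eq hZ hc (h.lastArrow_eq.symm.trans hl)

theorem IsPeriodic.length_pos {p : AnyPath Q} (h : IsPeriodic Z p) : 0 < p.2.2.length :=
  length_pos_of_lastArrow_eq h.lastArrow_eq.symm h.isPrimitive.1

theorem IsPeriodic.lastArrow_extend {p : AnyPath Q} (h : IsPeriodic Z p) (m : ℕ) :
    lastArrow (extend Z p m).2.2 = lastArrow (cycleOf Z p) :=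
  (lastArrow_comp_pathPow h.lastArrow_eq m).trans h.lastArrow_eq

theorem IsPeriodic.extend {p : AnyPath Q} (h : IsPeriodic Z p) (m : ℕ) :
    IsPeriodic Z (extend Z p m) :=
  ⟨cycleOf Z p, h.isPrimitive, h.lastArrow_extend m⟩

theorem IsPeriodic.cycleOf_extend (hZ : IsSpecial Z) {p : AnyPath Q} (h : IsPeriodic Z p) (m : ℕ) :
    cycleOf Z (StringAlg.extend Z p m) = cycleOf Z p :=
  IsPeriodic.eq_cycleOf (p := StringAlg.extend Z p m) hZ h.isPrimitive (h.lastArrow_extend m)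

theorem IsPeriodic.extend_extend (hZ : IsSpecial Z) {p : AnyPath Q} (h : IsPeriodic Z p)
    (m n : ℕ) : StringAlg.extend Z (StringAlg.extend Z p m) n = StringAlg.extend Z p (m + n) := by
  change (⟨p.1, p.2.1, _⟩ : AnyPath Q) = ⟨p.1, p.2.1, _⟩
  rw [h.cycleOf_extend hZ, pathPow_add, ← Quiver.Path.comp_assoc]
  rfl

theorem IsPeriodic.admissible_extend (hZ : IsSpecial Z) {p : AnyPath Q} (h : IsPeriodic Z p)
    (hp : IsAdmissible Z p.2.2) (m : ℕ) : IsAdmissible Z (StringAlg.extend Z p m).2.2 :=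
  h.isPrimitive.isPeriod.admissible_comp_pathPow hZ hp h.lastArrow_eq m

theorem length_extend (p : AnyPath Q) (m : ℕ) :
    (extend Z p m).2.2.length = p.2.2.length + m * (cycleOf Z p).length := by
  simp [extend, Quiver.Path.length_comp]

theorem IsPeriodic.extend_injective {p : AnyPath Q} (h : IsPeriodic Z p) :
    Function.Injective (StringAlg.extend Z p) := by
  intro m n hmn
  have := congrArg (fun p : AnyPath Q => p.2.2.length) hmn
  simp only [length_extend, add_right_inj] at this
  exact Nat.eq_of_mul_eq_mul_right h.isPrimitive.1 this

/-- Primitive cycles are stripped from the end until none is left. The condition `m = 0 ∨ IsPeriodic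
Z q` excludes spurious exponents: for `q` not periodic `cycleOf` is trivial by default and `extend`
ignores `m`. -/
theorem exists_isReduced (hZ : IsSpecial Z) {p : AnyPath Q} (hp : IsAdmissible Z p.2.2) :
    ∃ q, IsReduced Z q ∧ ∃ m, (m = 0 ∨ IsPeriodic Z q) ∧ p = extend Z q m := by
  induction hN : p.2.2.length using Nat.strong_induction_on generalizing p with
  | _ N ih =>
    by_cases hr : IsReduced Z p
    · exact ⟨p, hr, 0, Or.inl rfl, rfl⟩
    obtain ⟨x, y, p⟩ := p
    have : ∃ (q : Quiver.Path x y) (c : Quiver.Path y y), 0 < q.length ∧ IsPrimitive Z c ∧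
        p = q.comp c := by
      by_contra hcon
      push Not at hcon
      exact hr ⟨hp, hcon⟩
    obtain ⟨q, c, hq, hc, rfl⟩ := this
    have hlast := hc.isPeriod.lastArrow_eq hZ hp hq
    have hc0 := hc.1
    have hper : IsPeriodic Z ⟨x, y, q⟩ := ⟨c, hc, hlast⟩
    have hcyc : cycleOf Z ⟨x, y, q⟩ = c := IsPeriodic.eq_cycleOf hZ hc hlast
    have hext : extend Z ⟨x, y, q⟩ 1 = ⟨x, y, q.comp c⟩ := by
      rw [extend, hcyc, pathPow_one]
    obtain ⟨q', hq', m, hm, heq⟩ := ih q.length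
      (by simp only [Quiver.Path.length_comp] at hN; omega)
      (p := ⟨x, y, q⟩) hp.of_comp_left rfl
    have hper' : IsPeriodic Z q' := by
      rcases hm with rfl | hm
      · rw [extend_zero] at heq
        exact heq ▸ hper
      · exact hm
    refine ⟨q', hq', m + 1, Or.inr hper', ?_⟩
    rw [← hper'.extend_extend hZ, ← heq, hext]

theorem IsReduced.eq_of_extend_eq (hZ : IsSpecial Z) {p q : AnyPath Q} (hp : IsReduced Z p)
    (hq : IsReduced Z q) {m n : ℕ} (hm : m = 0 ∨ IsPeriodic Z p) (hn : n = 0 ∨ IsPeriodic Z q)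
    (h : extend Z p m = extend Z q n) : p = q := by
  wlog hmn : m ≤ n generalizing p q m n
  · exact (this hq hp hn hm h.symm (by omega)).symm
  -- Both sides end in the same primitive cycle, so its `m`-th power cancels; a remaining positive
  -- power would contradict that `p` is reduced.
  suffices h' : p = extend Z q (n - m) by
    rcases Nat.eq_zero_or_pos (n - m) with h0 | h0
    · rwa [h0, extend_zero] at h'
    · exfalso
      have hqp : IsPeriodic Z q := hn.resolve_left (by omega)
      obtain ⟨k, hk⟩ := Nat.exists_eq_succ_of_ne_zero h0.ne'
      rw [hk] at h'
      subst h'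
      refine hp.2 (extend Z q k).2.2 (cycleOf Z q) (hqp.extend k).length_pos hqp.isPrimitive ?_
      exact (Quiver.Path.comp_assoc q.2.2 (pathPow (cycleOf Z q) k) (cycleOf Z q)).symm
  rcases hm with rfl | hm
  · simpa using h
  rcases Nat.eq_zero_or_pos n with h0 | h0
  · obtain rfl : m = 0 := by omega
    simpa using h
  have hqp : IsPeriodic Z q := hn.resolve_left (by omega)
  have hc := hm.lastArrow_extend m
  have hc' := hqp.lastArrow_extend n
  obtain ⟨x, y, p⟩ := p
  obtain ⟨x', y', q⟩ := q
  have hx : x = x' := congrArg Sigma.fst h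
  have hy : y = y' := congrArg (fun p : AnyPath Q => p.2.1) h
  subst hx hy
  simp only [extend, Sigma.mk.injEq, heq_eq_eq, true_and] at h ⊢
  have hcc : cycleOf Z ⟨x, y, p⟩ = cycleOf Z ⟨x, y, q⟩ :=
    hm.isPrimitive.eq_of_lastArrow_eq hZ hqp.isPrimitive
      (hc.symm.trans ((congrArg lastArrow h).trans hc'))
  rw [hcc, show n = (n - m) + m by omega, pathPow_add, ← Quiver.Path.comp_assoc] at h
  exact Quiver.Path.comp_injective_left _ h

end Reduced

theorem mem_iSup_of_mem {A ι : Type*} [Ring A] {I : ι → TwoSidedIdeal A} (i : ι) {z : A}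
    (h : z ∈ I i) : z ∈ ⨆ i, I i :=
  le_iSup I i h

/-! ### Monomial subspaces of a path algebra -/

section Monomial

variable {R : Type w} [CommRing R] {Q : Type u} [Quiver.{v} Q]

open PathAlgebra

/-- The coefficient of a path in an element of the path algebra. -/
def coeffHom (R : Type w) [CommRing R] {Q : Type u} [Quiver.{v} Q] (p : AnyPath Q) :
    PathAlgebra R Q →ₗ[R] R := (basis R Q).coord p

theorem coeffHom_ofPath_self (p : AnyPath Q) : coeffHom R p (ofPath R p) = 1 := by
  simp [coeffHom, ofPath]

theorem coeffHom_ofPath_of_ne {p q : AnyPath Q} (h : q ≠ p) : coeffHom R p (ofPath R q) = 0 := by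
  simp [coeffHom, ofPath, h]

theorem ofPath_cons {x y z : Q} (p : Quiver.Path x y) (a : y ⟶ z) :
    ofPath R ⟨x, z, p.cons a⟩ = ofPath R ⟨y, z, a.toPath⟩ * ofPath R ⟨x, y, p⟩ := by
  rw [ofPath_mul_ofPath_comp]
  rfl

theorem vertex_mul_ofPath {R : Type*} [CommRing R] (p : AnyPath Q) :
    vertex R p.2.1 * ofPath R p = ofPath R p := by
  obtain ⟨x, y, p⟩ := p
  exact ofPath_mul_ofPath_comp _ _

/-- The subspace spanned by a set of paths. -/
def pathSpan (R : Type w) [CommRing R] (T : Set (AnyPath Q)) : Submodule R (PathAlgebra R Q) :=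
  Submodule.span R (ofPath R '' T)

theorem ofPath_mem_pathSpan {T : Set (AnyPath Q)} {p : AnyPath Q} (h : p ∈ T) :
    ofPath R p ∈ pathSpan R T :=
  Submodule.subset_span (Set.mem_image_of_mem _ h)

theorem coeffHom_eq_zero_of_mem_pathSpan {T : Set (AnyPath Q)} {x : PathAlgebra R Q}
    (hx : x ∈ pathSpan R T) {p : AnyPath Q} (hp : p ∉ T) : coeffHom R p x = 0 := by
  have : pathSpan R T ≤ LinearMap.ker (coeffHom R p) := by
    refine Submodule.span_le.mpr ?_
    rintro _ ⟨q, hq, rfl⟩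
    exact coeffHom_ofPath_of_ne (by rintro rfl; exact hp hq)
  exact this hx

theorem mul_mem_pathSpan {T₁ T₂ T₃ : Set (AnyPath Q)}
    (h : ∀ ⦃x y z : Q⦄ (p : Quiver.Path x y) (q : Quiver.Path y z),
      (⟨y, z, q⟩ : AnyPath Q) ∈ T₁ → (⟨x, y, p⟩ : AnyPath Q) ∈ T₂ →
        (⟨x, z, p.comp q⟩ : AnyPath Q) ∈ T₃)
    {a b : PathAlgebra R Q} (ha : a ∈ pathSpan R T₁) (hb : b ∈ pathSpan R T₂) :
    a * b ∈ pathSpan R T₃ := by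
  refine LinearMap.BilinMap.apply_apply_mem_of_mem_span (pathSpan R T₃) _ _ (mulHom R) ?_ a b ha hb
  rintro _ ⟨⟨y, z, q⟩, hq, rfl⟩ _ ⟨⟨x, y', p⟩, hp, rfl⟩
  rw [← mul_def]
  by_cases hy : y = y'
  · subst hy
    rw [ofPath_mul_ofPath_comp]
    exact ofPath_mem_pathSpan (h p q hq hp)
  · rw [ofPath_mul_ofPath_of_ne hy]
    exact Submodule.zero_mem _

theorem mem_pathSpan_univ (a : PathAlgebra R Q) : a ∈ pathSpan R (Set.univ : Set (AnyPath Q)) := by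
  rw [pathSpan, Set.image_univ]
  exact (basis R Q).mem_span a

variable [Fintype Q]

theorem smul_mem_of_mem {R : Type*} [CommRing R] (I : TwoSidedIdeal (PathAlgebra R Q))
    (r : R) {z : PathAlgebra R Q} (hz : z ∈ I) : r • z ∈ I := by
  rw [← one_mul z, ← smul_mul_assoc]
  exact I.mul_mem_left _ _ hz

/-- The two-sided ideal spanned by a set of paths which is closed under composition with arbitrary
paths. -/
def pathIdeal (R : Type w) [CommRing R] (T : Set (AnyPath Q))
    (h₁ : ∀ ⦃x y z : Q⦄ (p : Quiver.Path x y) (q : Quiver.Path y z),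
      (⟨y, z, q⟩ : AnyPath Q) ∈ T → (⟨x, z, p.comp q⟩ : AnyPath Q) ∈ T)
    (h₂ : ∀ ⦃x y z : Q⦄ (p : Quiver.Path x y) (q : Quiver.Path y z),
      (⟨x, y, p⟩ : AnyPath Q) ∈ T → (⟨x, z, p.comp q⟩ : AnyPath Q) ∈ T) :
    TwoSidedIdeal (PathAlgebra R Q) :=
  TwoSidedIdeal.mk' (pathSpan R T) (Submodule.zero_mem _) (Submodule.add_mem _)
    (Submodule.neg_mem _)
    (fun {a _} hb => mul_mem_pathSpan (fun _ _ _ p q _ hp => h₂ p q hp) (mem_pathSpan_univ a) hb)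
    (fun {_ b} ha => mul_mem_pathSpan (fun _ _ _ p q hq _ => h₁ p q hq) ha (mem_pathSpan_univ b))

theorem mem_pathIdeal {T : Set (AnyPath Q)} {h₁ h₂} {a : PathAlgebra R Q} :
    a ∈ pathIdeal R T h₁ h₂ ↔ a ∈ pathSpan R T := by
  simp [pathIdeal, TwoSidedIdeal.mem_mk']

theorem mem_pathSpan_of_mem_relationIdeal {Z : Set (AnyPath Q)} {a : PathAlgebra R Q}
    (ha : a ∈ relationIdeal R Z) : a ∈ pathSpan R {p : AnyPath Q | ¬ IsAdmissible Z p.2.2} := by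
  have : relationIdeal R Z ≤ pathIdeal R {p : AnyPath Q | ¬ IsAdmissible Z p.2.2}
      (fun _ _ _ p q h h' => h h'.of_comp_right) (fun _ _ _ p q h h' => h h'.of_comp_left) := by
    refine TwoSidedIdeal.span_le.mpr ?_
    rintro _ ⟨⟨x, y, p⟩, hp, rfl⟩
    refine mem_pathIdeal.mpr (ofPath_mem_pathSpan fun h => ?_)
    exact h _ _ .nil p .nil (by simp) hp
  exact mem_pathIdeal.mp (this ha)

theorem ofPath_mem_relationIdeal {Z : Set (AnyPath Q)} {x y : Q} {p : Quiver.Path x y}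
    (h : ¬ IsAdmissible Z p) : ofPath R ⟨x, y, p⟩ ∈ relationIdeal R Z := by
  unfold IsAdmissible at h
  push Not at h
  obtain ⟨x', y', q, z, r, rfl, hz⟩ := h
  rw [← ofPath_mul_ofPath_comp, ← ofPath_mul_ofPath_comp]
  exact TwoSidedIdeal.mul_mem_left _ _ _ (TwoSidedIdeal.mul_mem_right _ _ _
    (TwoSidedIdeal.subset_span ⟨_, hz, rfl⟩))

theorem ofPath_mem_arrowIdeal_pow {x y : Q} (p : Quiver.Path x y) :
    ofPath R ⟨x, y, p⟩ ∈ (arrowIdeal R Q).asIdeal ^ p.length := by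
  induction p with
  | nil => simp [Submodule.pow_zero]
  | cons p a ih =>
    rw [ofPath_cons, Quiver.Path.length_cons, Ideal.IsTwoSided.pow_succ]
    refine Ideal.mul_mem_mul ?_ ih
    exact TwoSidedIdeal.subset_span ⟨_, _, a, rfl⟩

theorem mem_pathSpan_of_mem_arrowIdeal_pow {d : ℕ} {a : PathAlgebra R Q}
    (ha : a ∈ (arrowIdeal R Q).asIdeal ^ d) :
    a ∈ pathSpan R {p : AnyPath Q | d ≤ p.2.2.length} := by
  have h1 : arrowIdeal R Q ≤ pathIdeal R {p : AnyPath Q | 1 ≤ p.2.2.length}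
      (fun _ _ _ p q h => by
        simp only [Set.mem_ofPred_eq, Quiver.Path.length_comp] at h ⊢; omega)
      (fun _ _ _ p q h => by
        simp only [Set.mem_ofPred_eq, Quiver.Path.length_comp] at h ⊢; omega) := by
    refine TwoSidedIdeal.span_le.mpr ?_
    rintro _ ⟨x, y, f, rfl⟩
    exact mem_pathIdeal.mpr (ofPath_mem_pathSpan (by simp))
  induction d generalizing a with
  | zero => simpa using mem_pathSpan_univ a
  | succ d ih =>
    rw [Ideal.IsTwoSided.pow_succ] at ha
    induction ha using Submodule.mul_induction_on' with
    | mem_mul_mem b hb c hc =>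
      refine mul_mem_pathSpan (fun x y z p q hq hp => ?_) (mem_pathIdeal.mp (h1 hb)) (ih hc)
      simp only [Set.mem_ofPred_eq, Quiver.Path.length_comp] at hp hq ⊢
      omega
    | add b _ c _ hb hc => exact Submodule.add_mem _ hb hc

end Monomial

/-! ### Lifting homomorphisms to path algebras over power series -/

section Lift

/-- Evaluation of power series takes place in the centre, which is commutative. With the discrete
topology there, nilpotent elements are topologically nilpotent, so they may be substituted for the
variables. -/
theorem exists_mvPowerSeries_algHom {k A : Type*} [Field k] [Ring A] [Algebra k A] {n : ℕ}
    (t : Fin n → A) (ht : ∀ i, t i ∈ Subalgebra.center k A) (hn : ∀ i, IsNilpotent (t i)) :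
    ∃ ρ : MvPowerSeries (Fin n) k →ₐ[k] A, (∀ f, ρ f ∈ Subalgebra.center k A) ∧
      ∀ i, ρ (MvPowerSeries.X i) = t i := by
  let A' := Subalgebra.center k A
  let s : Fin n → A' := fun i => ⟨t i, ht i⟩
  let _ : UniformSpace k := ⊥
  let _ : UniformSpace A' := ⊥
  have : DiscreteTopology k := inferInstance
  have : DiscreteTopology A' := inferInstance
  have : IsLinearTopology A' A' := inferInstance
  have : ContinuousSMul k A' := ⟨continuous_of_discreteTopology⟩
  have h : MvPowerSeries.HasEval s := by
    refine ⟨fun i => IsNilpotent.isTopologicallyNilpotent ?_, by simp [Filter.cofinite_eq_bot]⟩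
    obtain ⟨m, hm⟩ := hn i
    exact ⟨m, Subtype.ext (by simpa [s] using hm)⟩
  refine ⟨A'.val.comp (MvPowerSeries.aeval h), fun f => (MvPowerSeries.aeval h f).2, fun i => ?_⟩
  have := MvPowerSeries.aeval_coe h (MvPolynomial.X i : MvPolynomial (Fin n) k)
  simp only [MvPolynomial.coe_X, MvPolynomial.aeval_X] at this
  simp [this, s]

open PathAlgebra

/-- The universal property of `RQ ≅ R ⊗ kQ`: the values of `ρ` commute with those of `π`, so the
product of the two is multiplicative. -/
theorem exists_pathAlgebra_algHom {k : Type*} [Field k] {R : Type w} [CommRing R] [Algebra k R]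
    {Q : Type u} [Quiver.{v} Q] [Fintype Q] {A : Type*} [Ring A] [Algebra k A]
    (ρ : R →ₐ[k] A) (hρ : ∀ r, ρ r ∈ Subalgebra.center k A) (π : PathAlgebra k Q →ₐ[k] A) :
    ∃ θ : PathAlgebra R Q →ₐ[k] A, ∀ r p, θ (r • ofPath R p) = ρ r * π (ofPath k p) := by
  let f : PathAlgebra R Q →+ A := Finsupp.liftAddHom (fun p : AnyPath Q =>
    (AddMonoidHom.mulRight (π (ofPath k p))).comp (ρ : R →+ A))
  have hf : ∀ r p, f (r • ofPath R p) = ρ r * π (ofPath k p) := by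
    intro r p
    have : r • ofPath R p = (Finsupp.single p r : AnyPath Q →₀ R) := by
      change r • (Finsupp.single p 1 : AnyPath Q →₀ R) = _
      rw [Finsupp.smul_single, smul_eq_mul, mul_one]
    rw [this]
    exact Finsupp.liftAddHom_apply_single _ _ _
  have hcomm : ∀ r a, ρ r * a = a * ρ r := fun r a =>
    ((Subalgebra.mem_center_iff.mp (hρ r)) a).symm
  have hf1 : ∀ p, f (ofPath R p) = π (ofPath k p) := fun p => by
    have := hf 1 p
    rwa [one_smul, map_one, one_mul] at this
  have hmulp : ∀ p q : AnyPath Q, f (ofPath R p * ofPath R q) =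
      π (ofPath k p) * π (ofPath k q) := by
    rintro ⟨y, z, q⟩ ⟨x, y', p⟩
    rw [← map_mul]
    by_cases hy : y = y'
    · subst hy
      rw [ofPath_mul_ofPath_comp, ofPath_mul_ofPath_comp, hf1]
    · rw [ofPath_mul_ofPath_of_ne (R := R) hy, ofPath_mul_ofPath_of_ne (R := k) hy, map_zero,
        map_zero]
  have hsm : ∀ r a, f (r • a) = ρ r * f a := by
    intro r a
    induction a using PathAlgebra.induction_on with
    | zero => simp
    | add a b ha hb => rw [smul_add, map_add, ha, hb, map_add, mul_add]
    | smul s p => rw [smul_smul, hf, hf, map_mul, mul_assoc]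
  have hmul : ∀ a b, f (a * b) = f a * f b := by
    intro a b
    induction a using PathAlgebra.induction_on with
    | zero => simp
    | add a a' ha hb => rw [add_mul, map_add, ha, hb, map_add, add_mul]
    | smul r p =>
      induction b using PathAlgebra.induction_on with
      | zero => simp
      | add a a' ha hb => rw [mul_add, map_add, ha, hb, map_add, mul_add]
      | smul s q =>
        rw [smul_mul_assoc, mul_smul_comm, hsm, hsm, hmulp, hf, hf, mul_assoc (ρ r),
          ← mul_assoc (π (ofPath k p)) (ρ s), ← hcomm s (π (ofPath k p)), mul_assoc (ρ s)]
  have hone : f 1 = 1 := by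
    change f (∑ x : Q, vertex R x) = 1
    rw [map_sum, ← map_one π]
    change _ = π (∑ x : Q, vertex k x)
    rw [map_sum]
    exact Finset.sum_congr rfl fun x _ => hf1 _
  let g : PathAlgebra R Q →+* A := { f with map_one' := hone, map_mul' := hmul }
  refine ⟨{ g with commutes' := fun c => ?_ }, hf⟩
  change f (algebraMap k (PathAlgebra R Q) c) = _
  rw [Algebra.algebraMap_eq_smul_one, ← algebraMap_smul R c, hsm, hone, mul_one, AlgHom.commutes]

end Lift

/-! ### Arrows on primitive cycles and the partition of the primitive vertices. -/

section Nerve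

variable {Q : Type u} [Quiver.{v} Q] {Z : Set (AnyPath Q)}

theorem exists_cycleOf_eq_cons {x y : Q} {a : x ⟶ y}
    (h : IsPeriodic Z ⟨x, y, a.toPath⟩) :
    ∃ c : Quiver.Path y x, cycleOf Z ⟨x, y, a.toPath⟩ = c.cons a := by
  have hl := h.lastArrow_eq
  have h0 := h.isPrimitive.1
  generalize cycleOf Z ⟨x, y, a.toPath⟩ = d at *
  obtain ⟨z, c, b, rfl⟩ := exists_eq_cons h0
  cases hl
  exact ⟨c, rfl⟩

/-- After the last arrow of `c` both `a` and the first arrow of `c` may follow, so they are equal,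
and the rotation of `c` ending in `a` is a period. -/
theorem isPeriodic_toPath_of_admissible_cons (hZ : IsSpecial Z) {x y : Q} {a : x ⟶ y}
    {c : Quiver.Path x x} (hc : IsPrimitive Z c) (h : IsAdmissible Z (c.cons a)) :
    IsPeriodic Z ⟨x, y, a.toPath⟩ := by
  obtain ⟨z, f, d, rfl⟩ := exists_eq_toPath_comp hc.1
  obtain ⟨w, s, b, hs⟩ := exists_eq_cons hc.1
  have h1 : IsAdmissible Z ((s.cons b).comp (a.toPath.comp .nil)) := by
    rw [← hs]; exact h
  have h2 : IsAdmissible Z ((s.cons b).comp (f.toPath.comp d)) := by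
    rw [← hs]; exact hc.isPeriod.admissible_comp_self
  cases @hZ.1 _ _ b ⟨_, a⟩ h1.twoPath_notMem ⟨_, f⟩ h2.twoPath_notMem
  have hper : IsPeriod Z (d.cons a) := by
    refine ⟨by simp, fun m _ => ?_⟩
    have h3 := hc.2.1 (m + 1) (by omega)
    rw [pathPow_succ, ← Quiver.Path.comp_assoc, ← toPath_comp_pathPow] at h3
    exact h3.of_comp_left.of_comp_right
  obtain ⟨e, he, hel⟩ := hper.exists_isPrimitive
  exact ⟨e, he, hel.symm⟩

/-! ### The parts of the nerve -/

variable {n : ℕ} (e : Fin n ≃ NerveParts Z)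

theorem part_unique {i j : Fin n} {x : Q} (hi : x ∈ part e i) (hj : x ∈ part e j) : i = j := by
  obtain ⟨h, hi⟩ := hi
  obtain ⟨h', hj⟩ := hj
  exact e.injective (hi.symm.trans hj)

theorem mem_part_of_mem_traversed {x y z : Q} {c : Quiver.Path x x} (hc : IsPrimitive Z c)
    (hy : y ∈ traversed c) (hz : z ∈ traversed c) {i : Fin n} (h : y ∈ part e i) :
    z ∈ part e i := by
  obtain ⟨hy', h⟩ := h
  refine ⟨⟨x, c, hc, hz⟩, ?_⟩
  rw [← h]
  exact Quotient.sound (Relation.EqvGen.rel _ _ ⟨x, c, hc, hz, hy⟩)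

theorem exists_mem_part {x : Q} (h : x ∈ primitiveVertices Z) : ∃ i, x ∈ part e i :=
  ⟨e.symm (Quotient.mk _ ⟨x, h⟩), h, (e.apply_symm_apply _).symm⟩

theorem mem_traversed_self {x y : Q} (p : Quiver.Path x y) : y ∈ traversed p := ⟨p, .nil, rfl⟩

theorem IsPrimitive.mem_primitiveVertices {x : Q} {c : Quiver.Path x x} (hc : IsPrimitive Z c) :
    x ∈ primitiveVertices Z := ⟨x, c, hc, mem_traversed_self c⟩

theorem mem_part_iff_of_isPeriodic {x y : Q} {a : x ⟶ y}
    (h : IsPeriodic Z ⟨x, y, a.toPath⟩) (i : Fin n) : y ∈ part e i ↔ x ∈ part e i := by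
  obtain ⟨c, hc⟩ := exists_cycleOf_eq_cons h
  have hprim := h.isPrimitive
  rw [hc] at hprim
  have hx : x ∈ traversed (c.cons a) := ⟨c, a.toPath, rfl⟩
  have hy : y ∈ traversed (c.cons a) := mem_traversed_self _
  exact ⟨mem_part_of_mem_traversed e hprim hy hx, mem_part_of_mem_traversed e hprim hx hy⟩

end Nerve

/-! ### The elements `σ_x` -/

section Sigma

open PathAlgebra

variable {R : Type w} [CommRing R] {Q : Type u} [Quiver.{v} Q] [Fintype Q]
  [∀ x y : Q, Finite (x ⟶ y)] {Z : Set (AnyPath Q)}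

theorem finite_setOf_isPrimitive (hZ : IsSpecial Z) (x : Q) :
    {c : Quiver.Path x x | IsPrimitive Z c}.Finite :=
  Set.Finite.of_finite_image (f := lastArrow) (Set.toFinite _)
    fun _ hc _ hd h => IsPrimitive.eq_of_lastArrow_eq hZ hc hd h

theorem sigma_eq_sum (hZ : IsSpecial Z) (x : Q) :
    sigma R Z x = ∑ c ∈ (finite_setOf_isPrimitive hZ x).toFinset, ofPath R ⟨x, x, c⟩ :=
  finsum_mem_eq_finite_toFinset_sum _ _

/-- Only the primitive cycle with the last arrow of `p` can follow `p` admissibly; all other terms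
of `σ_y p` are in `⟨Z⟩`. -/
theorem sigma_mul_ofPath_sub_mem (hZ : IsSpecial Z) {x y : Q} {p : Quiver.Path x y}
    (h : IsPeriodic Z ⟨x, y, p⟩) :
    sigma R Z y * ofPath R ⟨x, y, p⟩ - ofPath R (extend Z ⟨x, y, p⟩ 1) ∈ relationIdeal R Z := by
  classical
  have hmem : cycleOf Z ⟨x, y, p⟩ ∈ (finite_setOf_isPrimitive hZ y).toFinset := by
    simpa using h.isPrimitive
  have hext : extend Z ⟨x, y, p⟩ 1 = ⟨x, y, p.comp (cycleOf Z ⟨x, y, p⟩)⟩ := by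
    rw [extend, pathPow_one]
  rw [sigma_eq_sum hZ, ← Finset.add_sum_erase _ _ hmem, add_mul, ofPath_mul_ofPath_comp, hext,
    add_sub_cancel_left, Finset.sum_mul]
  refine sum_mem fun c hc => ?_
  rw [ofPath_mul_ofPath_comp]
  simp only [Finset.mem_erase, Set.Finite.mem_toFinset, Set.mem_ofPred_eq] at hc
  refine ofPath_mem_relationIdeal fun hadm => hc.1 ?_
  exact (IsPeriodic.eq_cycleOf (p := ⟨x, y, p⟩) hZ hc.2
    (hc.2.isPeriod.lastArrow_eq hZ hadm h.length_pos)).symm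

theorem sigma_mul_ofPath_mem (hZ : IsSpecial Z) {x y : Q} {p : Quiver.Path x y}
    (hp : 0 < p.length) (h : ¬ IsPeriodic Z ⟨x, y, p⟩) :
    sigma R Z y * ofPath R ⟨x, y, p⟩ ∈ relationIdeal R Z := by
  rw [sigma_eq_sum hZ, Finset.sum_mul]
  refine sum_mem fun c hc => ?_
  rw [ofPath_mul_ofPath_comp]
  simp only [Set.Finite.mem_toFinset, Set.mem_ofPred_eq] at hc
  exact ofPath_mem_relationIdeal fun hadm =>
    h ⟨c, hc, hc.isPeriod.lastArrow_eq hZ hadm hp⟩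

/-- If `a` ends a primitive cycle `c a`, then `a c` is primitive by rotation and both products
reduce to the path `a c a`. Otherwise no primitive cycle composes admissibly with `a` on either
side. -/
theorem sigma_mul_arrow_sub_mem (hZ : IsSpecial Z) {x y : Q} (a : x ⟶ y) :
    sigma R Z y * ofPath R ⟨x, y, a.toPath⟩ - ofPath R ⟨x, y, a.toPath⟩ * sigma R Z x
      ∈ relationIdeal R Z := by
  classical
  by_cases h : IsPeriodic Z ⟨x, y, a.toPath⟩
  · obtain ⟨c, hc⟩ := exists_cycleOf_eq_cons h
    have hprim := h.isPrimitive
    have hext : extend Z ⟨x, y, a.toPath⟩ 1 = ⟨x, y, (a.toPath.comp c).cons a⟩ := by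
      rw [extend, pathPow_one, hc]
      rfl
    have h1 := sigma_mul_ofPath_sub_mem (R := R) hZ h
    rw [hext] at h1
    rw [hc] at hprim
    have hadm : IsAdmissible Z ((a.toPath.comp c).comp a.toPath) := by
      have := hprim.isPeriod.admissible_comp hZ
        (p := a.toPath) (hprim.isPeriod.admissible.of_comp_right (q := a.toPath)) rfl
      exact this
    have h2 : ofPath R ⟨x, y, a.toPath⟩ * sigma R Z x - ofPath R ⟨x, y, (a.toPath.comp c).cons a⟩
        ∈ relationIdeal R Z := by
      have hmem : a.toPath.comp c ∈ (finite_setOf_isPrimitive hZ x).toFinset := by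
        simpa using hprim.rotate
      rw [sigma_eq_sum hZ, ← Finset.add_sum_erase _ _ hmem, mul_add, ofPath_mul_ofPath_comp,
        Quiver.Path.comp_toPath_eq_cons, add_sub_cancel_left, Finset.mul_sum]
      refine sum_mem fun d hd => ?_
      rw [ofPath_mul_ofPath_comp]
      simp only [Finset.mem_erase, Set.Finite.mem_toFinset, Set.mem_ofPred_eq] at hd
      refine ofPath_mem_relationIdeal fun hadm' => hd.1 ?_
      exact hd.2.eq_of_lastArrow_eq hZ hprim.rotate (lastArrow_eq_of_admissible_comp hZ hadm' hadm
        hd.2.1 hprim.rotate.1 (by simp))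
    have := sub_mem h1 h2
    rwa [sub_sub_sub_cancel_right] at this
  · refine sub_mem (sigma_mul_ofPath_mem hZ (by simp) h) ?_
    rw [sigma_eq_sum hZ, Finset.mul_sum]
    refine sum_mem fun d hd => ?_
    rw [ofPath_mul_ofPath_comp]
    simp only [Set.Finite.mem_toFinset, Set.mem_ofPred_eq] at hd
    exact ofPath_mem_relationIdeal fun hadm =>
      h (isPeriodic_toPath_of_admissible_cons hZ hd hadm)

theorem ofPath_mul_arrow_sigma_mem (hZ : IsSpecial Z) {x y : Q} {a : x ⟶ y}
    (h : ¬ IsPeriodic Z ⟨x, y, a.toPath⟩) :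
    ofPath R ⟨x, y, a.toPath⟩ * sigma R Z x ∈ relationIdeal R Z := by
  have := sub_mem (sigma_mul_ofPath_mem (R := R) hZ (by simp) h)
    (sigma_mul_arrow_sub_mem (R := R) hZ a)
  rwa [sub_sub_cancel] at this

variable {n : ℕ} (e : Fin n ≃ NerveParts Z)

open Classical in
/-- The sum of the elements `σ_x` over the vertices `x` of one part. -/
def partSigma (R : Type w) [CommRing R] (e : Fin n ≃ NerveParts Z) (i : Fin n) :
    PathAlgebra R Q :=
  ∑ x with x ∈ part e i, sigma R Z x

theorem sigma_mul_ofPath_of_ne (hZ : IsSpecial Z) {z : Q} {p : AnyPath Q} (h : z ≠ p.2.1) :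
    sigma R Z z * ofPath R p = 0 := by
  rw [sigma_eq_sum hZ, Finset.sum_mul]
  exact Finset.sum_eq_zero fun c _ => ofPath_mul_ofPath_of_ne h

theorem ofPath_mul_sigma_of_ne (hZ : IsSpecial Z) {z : Q} {p : AnyPath Q} (h : z ≠ p.1) :
    ofPath R p * sigma R Z z = 0 := by
  rw [sigma_eq_sum hZ, Finset.mul_sum]
  exact Finset.sum_eq_zero fun c _ => ofPath_mul_ofPath_of_ne h.symm

theorem sigma_mul_vertex (hZ : IsSpecial Z) (x : Q) :
    sigma R Z x * vertex R x = sigma R Z x := by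
  rw [sigma_eq_sum hZ, Finset.sum_mul]
  refine Finset.sum_congr rfl fun c _ => ?_
  rw [vertex, ofPath_mul_ofPath_comp, Quiver.Path.nil_comp]

theorem vertex_mul_sigma (hZ : IsSpecial Z) (x : Q) :
    vertex R x * sigma R Z x = sigma R Z x := by
  rw [sigma_eq_sum hZ, Finset.mul_sum]
  refine Finset.sum_congr rfl fun c _ => ?_
  rw [vertex, ofPath_mul_ofPath_comp, Quiver.Path.comp_nil]

open Classical in
theorem partSigma_mul_ofPath (hZ : IsSpecial Z) (i : Fin n) (p : AnyPath Q) :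
    partSigma R e i * ofPath R p = if p.2.1 ∈ part e i then sigma R Z p.2.1 * ofPath R p else 0 := by
  rw [partSigma, Finset.sum_mul]
  split_ifs with h
  · exact Finset.sum_eq_single_of_mem _ (by simpa using h)
      fun z _ hz => sigma_mul_ofPath_of_ne hZ hz
  · refine Finset.sum_eq_zero fun z hz => sigma_mul_ofPath_of_ne hZ ?_
    rintro rfl
    exact h (by simpa using hz)

open Classical in
theorem ofPath_mul_partSigma (hZ : IsSpecial Z) (i : Fin n) (p : AnyPath Q) :
    ofPath R p * partSigma R e i = if p.1 ∈ part e i then ofPath R p * sigma R Z p.1 else 0 := by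
  rw [partSigma, Finset.mul_sum]
  split_ifs with h
  · exact Finset.sum_eq_single_of_mem _ (by simpa using h)
      fun z _ hz => ofPath_mul_sigma_of_ne hZ hz
  · refine Finset.sum_eq_zero fun z hz => ofPath_mul_sigma_of_ne hZ ?_
    rintro rfl
    exact h (by simpa using hz)

theorem partSigma_mul_arrow_sub_mem (hZ : IsSpecial Z) (i : Fin n) {x y : Q} (a : x ⟶ y) :
    partSigma R e i * ofPath R ⟨x, y, a.toPath⟩ - ofPath R ⟨x, y, a.toPath⟩ * partSigma R e i
      ∈ relationIdeal R Z := by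
  classical
  rw [partSigma_mul_ofPath e hZ, ofPath_mul_partSigma e hZ]
  by_cases h : IsPeriodic Z ⟨x, y, a.toPath⟩
  · simp only [mem_part_iff_of_isPeriodic e h]
    split_ifs
    · exact sigma_mul_arrow_sub_mem hZ a
    · simp [zero_mem]
  -- Here the ends of `a` may lie in different parts, but each product is separately a relation.
  · refine sub_mem ?_ ?_
    · split_ifs
      · exact sigma_mul_ofPath_mem hZ (by simp) h
      · exact zero_mem _
    · split_ifs
      · exact ofPath_mul_arrow_sigma_mem hZ h
      · exact zero_mem _

/-- `partSigma` is central modulo the relations. -/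
theorem partSigma_mul_sub_mem (hZ : IsSpecial Z) (i : Fin n) (z : PathAlgebra R Q) :
    partSigma R e i * z - z * partSigma R e i ∈ relationIdeal R Z := by
  classical
  induction z using PathAlgebra.induction_on with
  | zero => simp [zero_mem]
  | add a b ha hb =>
    rw [mul_add, add_mul, add_sub_add_comm]
    exact add_mem ha hb
  | smul r p =>
    rw [mul_smul_comm, smul_mul_assoc, ← smul_sub, ← one_mul (_ - _), ← smul_mul_assoc]
    refine TwoSidedIdeal.mul_mem_left _ _ _ ?_
    obtain ⟨x, y, p⟩ := p
    induction p with
    | nil =>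
      rw [partSigma_mul_ofPath e hZ, ofPath_mul_partSigma e hZ]
      have h1 := sigma_mul_vertex (R := R) hZ x
      have h2 := vertex_mul_sigma (R := R) hZ x
      rw [vertex] at h1 h2
      simp [h1, h2, zero_mem]
    | cons p a ih =>
      rw [ofPath_cons]
      -- Leibniz rule for the commutator with `partSigma R e i`.
      have h1 := TwoSidedIdeal.mul_mem_right (relationIdeal R Z) _ (ofPath R ⟨_, _, p⟩)
        (partSigma_mul_arrow_sub_mem (R := R) e hZ i a)
      have h2 := TwoSidedIdeal.mul_mem_left (relationIdeal R Z) (ofPath R ⟨_, _, a.toPath⟩) _ ih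
      have h3 := add_mem h1 h2
      rw [sub_mul, mul_sub] at h3
      simp only [mul_assoc, sub_add_sub_cancel] at h3 ⊢
      exact h3

theorem partSigma_mem_arrowIdeal (hZ : IsSpecial Z) (i : Fin n) :
    partSigma R e i ∈ arrowIdeal R Q := by
  classical
  refine sum_mem fun x _ => ?_
  rw [sigma_eq_sum hZ]
  refine sum_mem fun c hc => ?_
  simp only [Set.Finite.mem_toFinset, Set.mem_ofPred_eq] at hc
  obtain ⟨z, q, b, rfl⟩ := exists_eq_cons hc.1
  rw [ofPath_cons]
  exact TwoSidedIdeal.mul_mem_right _ _ _ (TwoSidedIdeal.subset_span ⟨_, _, b, rfl⟩)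

end Sigma

/-- Each monomial that occurs contains a variable outside `P`. One such variable is chosen per
monomial and the monomials are grouped by this choice. -/
theorem mvPowerSeries_eq_sum_X_mul {k : Type*} [CommRing k] {n : ℕ} (P : Fin n → Prop)
    [DecidablePred P] (f : MvPowerSeries (Fin n) k)
    (h : ∀ α : Fin n →₀ ℕ, (∀ i, α i ≠ 0 → P i) → MvPowerSeries.coeff α f = 0) :
    ∃ g : Fin n → MvPowerSeries (Fin n) k, f = ∑ i with ¬ P i, MvPowerSeries.X i * g i := by
  classical
  have hsel : ∀ α : Fin n →₀ ℕ, ¬ (∀ i, α i ≠ 0 → P i) → ∃ i, α i ≠ 0 ∧ ¬ P i := by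
    intro α hα
    push Not at hα
    exact hα
  let part : Fin n → MvPowerSeries (Fin n) k := fun i α =>
    if hα : ¬ (∀ i, α i ≠ 0 → P i) then
      if (hsel α hα).choose = i then MvPowerSeries.coeff α f else 0
    else 0
  have hdvd : ∀ i, MvPowerSeries.X i ∣ part i := by
    intro i
    rw [MvPowerSeries.X_dvd_iff]
    intro α hα
    change (if hα : ¬ (∀ i, α i ≠ 0 → P i) then
      if (hsel α hα).choose = i then MvPowerSeries.coeff α f else 0 else 0) = 0
    split_ifs with h1 h2
    · rfl
    · exact absurd (h2 ▸ hα) (hsel α h1).choose_spec.1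
    · rfl
  choose g hg using hdvd
  refine ⟨g, ?_⟩
  simp only [← hg]
  ext α
  rw [map_sum]
  change _ = ∑ i with ¬ P i, if hα : ¬ (∀ i, α i ≠ 0 → P i) then
      if (hsel α hα).choose = i then MvPowerSeries.coeff α f else 0 else 0
  by_cases hα : ∀ i, α i ≠ 0 → P i
  · rw [h α hα]
    exact (Finset.sum_eq_zero fun i _ => dif_neg (not_not.mpr hα)).symm
  · simp only [dif_pos hα]
    rw [Finset.sum_ite_eq, if_pos (by simpa using (hsel α hα).choose_spec.2)]

/-! ### Normal forms in the path algebra over power series. -/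

section NormalForm

open PathAlgebra

variable {k : Type w} [Field k] {Q : Type u} [Quiver.{v} Q] {Z : Set (AnyPath Q)}
  {n : ℕ} (e : Fin n ≃ NerveParts Z)

/-- The path `p` is periodic and its head lies in the `i`-th part. -/
def IsPeriodicAt (p : AnyPath Q) (i : Fin n) : Prop :=
  IsPeriodic Z p ∧ p.2.1 ∈ part e i

/-- The exponents of the monomials which act on the path `p` by extension. -/
def exponents (p : AnyPath Q) : Set (Fin n →₀ ℕ) :=
  {α | ∀ i, α i ≠ 0 → IsPeriodicAt e p i}

theorem zero_mem_exponents (p : AnyPath Q) : 0 ∈ exponents e p := fun _ h => absurd rfl h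

theorem single_mem_exponents {p : AnyPath Q} {i : Fin n} (h : IsPeriodicAt e p i) (m : ℕ) :
    Finsupp.single i m ∈ exponents e p := by
  intro j hj
  obtain rfl : i = j := by
    by_contra hne
    exact hj (Finsupp.single_eq_of_ne' hne)
  exact h

variable {e}

/-- The parts are disjoint, so at most one variable extends `p`; the total degree then counts the
cycles appended. -/
theorem eq_single_of_mem_exponents {p : AnyPath Q} {i : Fin n} (h : IsPeriodicAt e p i)
    {α : Fin n →₀ ℕ} (hα : α ∈ exponents e p) : α = Finsupp.single i α.degree := by
  have h1 : α = Finsupp.single i (α i) := by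
    ext j
    by_cases hj : i = j
    · subst hj; simp
    · rw [Finsupp.single_eq_of_ne' hj]
      by_contra h0
      exact hj (part_unique e h.2 (hα j h0).2)
  have h2 : α.degree = α i := by rw [h1]; simp
  rw [h2, ← h1]

theorem eq_zero_of_mem_exponents {p : AnyPath Q} (h : ¬ IsPeriodic Z p)
    {α : Fin n →₀ ℕ} (hα : α ∈ exponents e p) : α = 0 := by
  ext j
  by_contra h0
  exact h (hα j h0).1

theorem exists_isPeriodicAt (e : Fin n ≃ NerveParts Z) {p : AnyPath Q} (h : IsPeriodic Z p) :
    ∃ i, IsPeriodicAt e p i := by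
  obtain ⟨i, hi⟩ := exists_mem_part e h.isPrimitive.mem_primitiveVertices
  exact ⟨i, h, hi⟩

theorem degree_eq_zero_or_isPeriodic {p : AnyPath Q} {α : Fin n →₀ ℕ} (hα : α ∈ exponents e p) :
    α.degree = 0 ∨ IsPeriodic Z p := by
  by_cases h : IsPeriodic Z p
  · exact Or.inr h
  · rw [eq_zero_of_mem_exponents h hα]; simp

theorem eq_of_extend_degree_eq {p : AnyPath Q} {α β : Fin n →₀ ℕ} (hα : α ∈ exponents e p)
    (hβ : β ∈ exponents e p) (h : extend Z p α.degree = extend Z p β.degree) : α = β := by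
  by_cases hp : IsPeriodic Z p
  · obtain ⟨i, hi⟩ := exists_isPeriodicAt e hp
    rw [eq_single_of_mem_exponents hi hα, eq_single_of_mem_exponents hi hβ, hp.extend_injective h]
  · rw [eq_zero_of_mem_exponents hp hα, eq_zero_of_mem_exponents hp hβ]

theorem exists_mem_exponents (e : Fin n ≃ NerveParts Z) {p : AnyPath Q} {m : ℕ}
    (h : m = 0 ∨ IsPeriodic Z p) :
    ∃ α ∈ exponents e p, α.degree = m := by
  rcases h with rfl | h
  · exact ⟨0, zero_mem_exponents e p, by simp⟩
  · obtain ⟨i, hi⟩ := exists_isPeriodicAt e h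
    exact ⟨Finsupp.single i m, single_mem_exponents e hi m, by simp⟩

variable (e) in
open Classical in
/-- The power series whose coefficients are the values of `a` at the extensions of `p`. -/
def extensionSeries (p : AnyPath Q) : (AnyPath Q → k) →ₗ[k] MvPowerSeries (Fin n) k where
  toFun a α := if α ∈ exponents e p then a (extend Z p α.degree) else 0
  map_add' a b := by
    funext α
    change _ = (if α ∈ exponents e p then a _ else 0) + (if α ∈ exponents e p then b _ else 0)
    split_ifs <;> simp
  map_smul' c a := by
    funext α
    change _ = c * (if α ∈ exponents e p then a _ else 0)
    split_ifs <;> simp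

open Classical in
theorem coeff_extensionSeries (p : AnyPath Q) (a : AnyPath Q → k) (α : Fin n →₀ ℕ) :
    MvPowerSeries.coeff α (extensionSeries e p a) =
      if α ∈ exponents e p then a (extend Z p α.degree) else 0 := rfl

theorem extensionSeries_eq_zero {p : AnyPath Q} {a : AnyPath Q → k}
    (h : ∀ m, (m = 0 ∨ IsPeriodic Z p) → a (extend Z p m) = 0) : extensionSeries e p a = 0 := by
  classical
  ext α
  rw [coeff_extensionSeries]
  split_ifs with hα
  · exact h _ (degree_eq_zero_or_isPeriodic hα)
  · rfl

open Classical in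
theorem extensionSeries_single {p : AnyPath Q} {α : Fin n →₀ ℕ} (hα : α ∈ exponents e p) :
    extensionSeries e p (Pi.single (extend Z p α.degree) (1 : k)) = MvPowerSeries.monomial α 1 := by
  ext β
  rw [coeff_extensionSeries, MvPowerSeries.coeff_monomial]
  by_cases hβ : β ∈ exponents e p
  · rw [if_pos hβ, Pi.single_apply]
    congr 1
    simp only [eq_iff_iff]
    exact ⟨fun h => eq_of_extend_degree_eq hβ hα h, fun h => by rw [h]⟩
  · rw [if_neg hβ, if_neg]
    rintro rfl
    exact hβ hα

variable [Fintype Q]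

variable (k e) in
/-- The ideal of the path algebra over power series. -/
abbrev powerIdeal : TwoSidedIdeal (PathAlgebra (MvPowerSeries (Fin n) k) Q) :=
  stringIdeal Z e (fun i => (MvPowerSeries.X i : MvPowerSeries (Fin n) k))

theorem relationIdeal_le : relationIdeal (MvPowerSeries (Fin n) k) Z ≤ powerIdeal k e :=
  le_sup_left

theorem X_smul_vertex_sub_mem {x : Q} {i : Fin n} (h : x ∈ part e i) :
    (MvPowerSeries.X i : MvPowerSeries (Fin n) k) • vertex (MvPowerSeries (Fin n) k) x
      - sigma (MvPowerSeries (Fin n) k) Z x ∈ powerIdeal k e := by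
  refine TwoSidedIdeal.mem_sup_right ?_
  exact mem_iSup_of_mem i
    (TwoSidedIdeal.mem_sup_left (TwoSidedIdeal.subset_span ⟨x, h, rfl⟩))

theorem X_smul_vertex_mem {x : Q} {i : Fin n} (h : x ∉ part e i) :
    (MvPowerSeries.X i : MvPowerSeries (Fin n) k) • vertex (MvPowerSeries (Fin n) k) x
      ∈ powerIdeal k e := by
  refine TwoSidedIdeal.mem_sup_right ?_
  exact mem_iSup_of_mem i
    (TwoSidedIdeal.mem_sup_right (TwoSidedIdeal.subset_span ⟨x, h, rfl⟩))

variable [∀ x y : Q, Finite (x ⟶ y)]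

variable (e) in
/-- The element of the path algebra over power series attached to a family of coefficients of
admissible paths. -/
def normalForm (hZ : IsSpecial Z) :
    (AnyPath Q → k) →ₗ[k] PathAlgebra (MvPowerSeries (Fin n) k) Q :=
  ∑ p ∈ (finite_setOf_isReduced hZ).toFinset,
    ((LinearMap.toSpanSingleton (MvPowerSeries (Fin n) k) _
      (ofPath (MvPowerSeries (Fin n) k) p)).restrictScalars k).comp (extensionSeries e p)

theorem normalForm_apply (hZ : IsSpecial Z) (a : AnyPath Q → k) :
    normalForm e hZ a = ∑ p ∈ (finite_setOf_isReduced hZ).toFinset,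
      extensionSeries e p a • ofPath (MvPowerSeries (Fin n) k) p := by
  simp [normalForm]

theorem normalForm_eq_zero (hZ : IsSpecial Z) {a : AnyPath Q → k}
    (h : ∀ p : AnyPath Q, IsAdmissible Z p.2.2 → a p = 0) : normalForm e hZ a = 0 := by
  rw [normalForm_apply]
  refine Finset.sum_eq_zero fun p hp => ?_
  rw [extensionSeries_eq_zero, zero_smul]
  intro m hm
  apply h
  have hadm : IsAdmissible Z p.2.2 := ((Set.Finite.mem_toFinset _).mp hp).1
  rcases hm with rfl | hm
  · exact hadm
  · exact hm.admissible_extend hZ hadm m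

/-- Extensions of different reduced paths are different, so only the summand of `q` sees `a`. -/
theorem normalForm_eq_smul (hZ : IsSpecial Z) {q : AnyPath Q} (hq : IsReduced Z q)
    {a : AnyPath Q → k}
    (h : ∀ p, (∀ m, (m = 0 ∨ IsPeriodic Z q) → p ≠ extend Z q m) → a p = 0) :
    normalForm e hZ a = extensionSeries e q a • ofPath (MvPowerSeries (Fin n) k) q := by
  rw [normalForm_apply]
  refine Finset.sum_eq_single_of_mem q ((Set.Finite.mem_toFinset _).mpr hq) fun p hp hpq => ?_
  rw [extensionSeries_eq_zero, zero_smul]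
  intro m hm
  refine h _ fun m' hm' heq => hpq ?_
  exact ((Set.Finite.mem_toFinset _).mp hp).eq_of_extend_eq hZ hq hm hm' heq

/-! ### Congruences modulo the ideal -/

/-- The generator `t_i e_y - σ_y` times `p`, where `σ_y p` is the extension of `p` modulo `⟨Z⟩`. -/
theorem X_smul_ofPath_sub_mem (hZ : IsSpecial Z) {p : AnyPath Q} {i : Fin n}
    (h : IsPeriodicAt e p i) :
    (MvPowerSeries.X i : MvPowerSeries (Fin n) k) • ofPath (MvPowerSeries (Fin n) k) p
      - ofPath (MvPowerSeries (Fin n) k) (extend Z p 1) ∈ powerIdeal k e := by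
  have h1 := (powerIdeal k e).mul_mem_right _ (ofPath (MvPowerSeries (Fin n) k) p)
    (X_smul_vertex_sub_mem (k := k) h.2)
  rw [sub_mul, smul_mul_assoc, vertex_mul_ofPath] at h1
  have h2 := relationIdeal_le (k := k) (e := e) (sigma_mul_ofPath_sub_mem hZ h.1)
  simpa using add_mem h1 h2

theorem X_smul_ofPath_mem (hZ : IsSpecial Z) {p : AnyPath Q} (hp : 0 < p.2.2.length) {i : Fin n}
    (h : ¬ IsPeriodicAt e p i) :
    (MvPowerSeries.X i : MvPowerSeries (Fin n) k) • ofPath (MvPowerSeries (Fin n) k) p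
      ∈ powerIdeal k e := by
  by_cases hi : p.2.1 ∈ part e i
  · have h1 := (powerIdeal k e).mul_mem_right _ (ofPath (MvPowerSeries (Fin n) k) p)
      (X_smul_vertex_sub_mem (k := k) hi)
    rw [sub_mul, smul_mul_assoc, vertex_mul_ofPath] at h1
    have h2 := relationIdeal_le (k := k) (e := e)
      (sigma_mul_ofPath_mem hZ hp fun hper => h ⟨hper, hi⟩)
    simpa using add_mem h1 h2
  · have h1 := (powerIdeal k e).mul_mem_right _ (ofPath (MvPowerSeries (Fin n) k) p)
      (X_smul_vertex_mem (k := k) hi)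
    rwa [smul_mul_assoc, vertex_mul_ofPath] at h1

theorem X_pow_smul_ofPath_sub_mem (hZ : IsSpecial Z) {p : AnyPath Q} {i : Fin n}
    (h : IsPeriodicAt e p i) (m : ℕ) :
    (MvPowerSeries.X i ^ m : MvPowerSeries (Fin n) k) • ofPath (MvPowerSeries (Fin n) k) p
      - ofPath (MvPowerSeries (Fin n) k) (extend Z p m) ∈ powerIdeal k e := by
  induction m with
  | zero => simp [zero_mem]
  | succ m ih =>
    have h1 := smul_mem_of_mem _ (MvPowerSeries.X i) ih
    have h2 := X_smul_ofPath_sub_mem (k := k) hZ (p := extend Z p m) ⟨h.1.extend m, h.2⟩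
    rw [h.1.extend_extend hZ] at h2
    have := add_mem h1 h2
    rwa [smul_sub, smul_smul, ← pow_succ', sub_add_sub_cancel] at this

theorem monomial_smul_ofPath_sub_mem (hZ : IsSpecial Z) {p : AnyPath Q} {α : Fin n →₀ ℕ}
    (hα : α ∈ exponents e p) :
    (MvPowerSeries.monomial α 1 : MvPowerSeries (Fin n) k) • ofPath (MvPowerSeries (Fin n) k) p
      - ofPath (MvPowerSeries (Fin n) k) (extend Z p α.degree) ∈ powerIdeal k e := by
  by_cases hp : IsPeriodic Z p
  · obtain ⟨i, hi⟩ := exists_isPeriodicAt e hp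
    have := X_pow_smul_ofPath_sub_mem (k := k) hZ hi α.degree
    rwa [MvPowerSeries.X_pow_eq, ← eq_single_of_mem_exponents hi hα] at this
  · rw [eq_zero_of_mem_exponents hp hα]
    simp [zero_mem]

/-- For `p` admissible with reduced part `q`, the left-hand term is a monomial times `q`, and modulo
the ideal that monomial extends `q` to `p`. -/
theorem normalForm_single_sub_mem [DecidableEq (AnyPath Q)] (hZ : IsSpecial Z) (p : AnyPath Q) :
    normalForm e hZ (Pi.single p (1 : k)) - ofPath (MvPowerSeries (Fin n) k) p
      ∈ powerIdeal k e := by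
  by_cases hp : IsAdmissible Z p.2.2
  · obtain ⟨q, hq, m, hm, rfl⟩ := exists_isReduced hZ hp
    obtain ⟨α, hα, rfl⟩ := exists_mem_exponents e hm
    rw [normalForm_eq_smul hZ hq]
    · have := monomial_smul_ofPath_sub_mem (k := k) hZ hα
      rw [← extensionSeries_single hα] at this
      convert this
    · intro p hp
      exact Pi.single_eq_of_ne (hp _ hm) _
  · rw [normalForm_eq_zero hZ, zero_sub]
    · exact neg_mem (relationIdeal_le (ofPath_mem_relationIdeal hp))
    · intro q hq
      refine Pi.single_eq_of_ne ?_ _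
      rintro rfl
      exact hp hq

/-- Every monomial of `f` contains a variable that kills `p`. This fails for trivial paths, where
`t_i e_x` may be congruent to a non-zero `σ_x`. -/
theorem smul_ofPath_mem (hZ : IsSpecial Z) {p : AnyPath Q} (hp : 0 < p.2.2.length)
    {f : MvPowerSeries (Fin n) k}
    (hf : ∀ α ∈ exponents e p, MvPowerSeries.coeff α f = 0) :
    f • ofPath (MvPowerSeries (Fin n) k) p ∈ powerIdeal k e := by
  classical
  obtain ⟨g, rfl⟩ := mvPowerSeries_eq_sum_X_mul (IsPeriodicAt e p) f hf
  rw [Finset.sum_smul]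
  refine sum_mem fun i hi => ?_
  rw [mul_comm, mul_smul]
  exact smul_mem_of_mem _ _ (X_smul_ofPath_mem hZ hp (by simpa using hi))

theorem exists_normalForm_of_support (hZ : IsSpecial Z) {q : AnyPath Q} (hq : IsReduced Z q)
    {f : MvPowerSeries (Fin n) k} (hf : ∀ α ∉ exponents e q, MvPowerSeries.coeff α f = 0) :
    ∃ a, f • ofPath (MvPowerSeries (Fin n) k) q = normalForm e hZ a := by
  classical
  -- The chosen exponent is harmless: an extension of `q` determines its exponent by
  -- `eq_of_extend_degree_eq`.
  let a : AnyPath Q → k := fun p =>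
    if h : ∃ α ∈ exponents e q, p = extend Z q α.degree then MvPowerSeries.coeff h.choose f else 0
  refine ⟨a, ?_⟩
  rw [normalForm_eq_smul hZ hq]
  · congr 1
    ext α
    rw [coeff_extensionSeries]
    split_ifs with hα
    · have h : ∃ β ∈ exponents e q, extend Z q α.degree = extend Z q β.degree := ⟨α, hα, rfl⟩
      simp only [a]
      rw [dif_pos h, ← eq_of_extend_degree_eq hα h.choose_spec.1 h.choose_spec.2]
    · exact hf α hα
  · intro p hp
    simp only [a]
    rw [dif_neg]
    rintro ⟨α, hα, rfl⟩
    exact hp _ (degree_eq_zero_or_isPeriodic hα) rfl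

theorem exists_normalForm_smul_reduced (hZ : IsSpecial Z) {q : AnyPath Q} (hq : IsReduced Z q)
    (hq0 : 0 < q.2.2.length) (f : MvPowerSeries (Fin n) k) :
    ∃ a, f • ofPath (MvPowerSeries (Fin n) k) q - normalForm e hZ a ∈ powerIdeal k e := by
  classical
  let g : MvPowerSeries (Fin n) k := fun α =>
    if α ∈ exponents e q then MvPowerSeries.coeff α f else 0
  have hg : ∀ α, MvPowerSeries.coeff α g =
    if α ∈ exponents e q then MvPowerSeries.coeff α f else 0 := fun α => rfl
  obtain ⟨a, ha⟩ := exists_normalForm_of_support (e := e) (k := k) hZ hq (f := g)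
    fun α hα => by rw [hg, if_neg hα]
  refine ⟨a, ?_⟩
  rw [← ha, ← sub_smul]
  exact smul_ofPath_mem hZ hq0 fun α hα => by rw [map_sub, hg, if_pos hα, sub_self]

theorem exists_normalForm_smul_ofPath (hZ : IsSpecial Z) {p : AnyPath Q}
    (hp0 : 0 < p.2.2.length) (f : MvPowerSeries (Fin n) k) :
    ∃ a, f • ofPath (MvPowerSeries (Fin n) k) p - normalForm e hZ a ∈ powerIdeal k e := by
  by_cases hp : IsAdmissible Z p.2.2
  · obtain ⟨q, hq, m, hm, rfl⟩ := exists_isReduced hZ hp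
    obtain ⟨α, hα, rfl⟩ := exists_mem_exponents e hm
    have hq0 : 0 < q.2.2.length := by
      rcases hm with hm | hm
      · rwa [hm] at hp0
      · exact hm.length_pos
    obtain ⟨a, ha⟩ := exists_normalForm_smul_reduced (e := e) (k := k) hZ hq hq0
      (f * MvPowerSeries.monomial α 1)
    refine ⟨a, ?_⟩
    have := sub_mem ha
      (smul_mem_of_mem _ f (monomial_smul_ofPath_sub_mem (k := k) hZ hα))
    rw [smul_sub, smul_smul] at this
    convert this using 1
    abel
  · refine ⟨0, ?_⟩
    rw [map_zero, sub_zero]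
    exact smul_mem_of_mem _ _ (relationIdeal_le (ofPath_mem_relationIdeal hp))

variable (k e) in
/-- The elements which are congruent to a normal form. -/
def normalizable (hZ : IsSpecial Z) : AddSubgroup (PathAlgebra (MvPowerSeries (Fin n) k) Q) where
  carrier := {y | ∃ a, y - normalForm e hZ a ∈ powerIdeal k e}
  zero_mem' := ⟨0, by simp [zero_mem]⟩
  add_mem' := by
    rintro y z ⟨a, ha⟩ ⟨b, hb⟩
    refine ⟨a + b, ?_⟩
    rw [map_add, add_sub_add_comm]
    exact add_mem ha hb
  neg_mem' := by
    rintro y ⟨a, ha⟩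
    refine ⟨-a, ?_⟩
    rw [map_neg, ← neg_sub']
    exact neg_mem ha

theorem mem_normalizable_of_sub_mem {hZ : IsSpecial Z}
    {y z : PathAlgebra (MvPowerSeries (Fin n) k) Q}
    (h : y - z ∈ powerIdeal k e) (hz : z ∈ normalizable k e hZ) : y ∈ normalizable k e hZ := by
  obtain ⟨a, ha⟩ := hz
  refine ⟨a, ?_⟩
  have := add_mem h ha
  rwa [sub_add_sub_cancel] at this

/-- The constant term of `f` already gives a normal form. In the rest a variable splits off, and
`t_i e_x` is replaced by `σ_x` or `0`, which reduces to paths of positive length. -/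
theorem smul_vertex_mem_normalizable (hlen : ∀ p ∈ Z, 2 ≤ p.2.2.length) (hZ : IsSpecial Z) (x : Q)
    (f : MvPowerSeries (Fin n) k) :
    f • vertex (MvPowerSeries (Fin n) k) x ∈ normalizable k e hZ := by
  classical
  have hC : MvPowerSeries.C (σ := Fin n) (MvPowerSeries.constantCoeff f) • vertex (MvPowerSeries (Fin n) k) x
      ∈ normalizable k e hZ := by
    obtain ⟨a, ha⟩ := exists_normalForm_of_support (e := e) (k := k) hZ (isReduced_nil hlen x)
      (f := MvPowerSeries.C (MvPowerSeries.constantCoeff f)) (fun α hα => by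
        rw [MvPowerSeries.coeff_C, if_neg]
        rintro rfl
        exact hα (zero_mem_exponents e _))
    refine ⟨a, ?_⟩
    rw [← ha, vertex, sub_self]
    exact zero_mem _
  -- With the predicate `False` all variables are allowed and only the constant term must vanish.
  obtain ⟨g, hg⟩ := mvPowerSeries_eq_sum_X_mul (fun _ : Fin n => False)
    (f - MvPowerSeries.C (MvPowerSeries.constantCoeff f)) (fun α hα => by
      obtain rfl : α = 0 := by
        ext i
        by_contra h
        exact hα i h
      simp)
  rw [← sub_add_cancel f (MvPowerSeries.C (MvPowerSeries.constantCoeff f)), add_smul]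
  refine add_mem ?_ hC
  rw [hg, Finset.sum_smul]
  refine sum_mem fun i _ => ?_
  rw [mul_comm, mul_smul]
  by_cases hi : x ∈ part e i
  · refine mem_normalizable_of_sub_mem (z := g i • sigma _ Z x) ?_ ?_
    · rw [← smul_sub]
      exact smul_mem_of_mem _ _ (X_smul_vertex_sub_mem hi)
    · rw [sigma_eq_sum hZ, Finset.smul_sum]
      refine sum_mem fun c hc => ?_
      exact exists_normalForm_smul_ofPath hZ ((Set.Finite.mem_toFinset _).mp hc).1 _
  · exact mem_normalizable_of_sub_mem (z := 0)
      (by rw [sub_zero]; exact smul_mem_of_mem _ _ (X_smul_vertex_mem hi)) (zero_mem _)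

/-- Every element of the path algebra over power series is congruent to a normal form. -/
theorem exists_normalForm (hlen : ∀ p ∈ Z, 2 ≤ p.2.2.length) (hZ : IsSpecial Z)
    (y : PathAlgebra (MvPowerSeries (Fin n) k) Q) :
    ∃ a, y - normalForm e hZ a ∈ powerIdeal k e := by
  suffices y ∈ normalizable k e hZ from this
  induction y using PathAlgebra.induction_on with
  | zero => exact zero_mem _
  | add y z hy hz => exact add_mem hy hz
  | smul f p =>
    obtain ⟨x, y, p⟩ := p
    rcases Nat.eq_zero_or_pos p.length with h0 | h0
    · cases p with
      | nil => exact smul_vertex_mem_normalizable hlen hZ x f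
      | cons => simp at h0
    · exact exists_normalForm_smul_ofPath hZ h0 f

end NormalForm

/-- Two homomorphisms with the same range have isomorphic quotients by their kernels. -/
theorem nonempty_quotient_algEquiv {k A B C : Type*} [CommRing k] [Ring A] [Ring B] [Ring C] [Algebra k A]
    [Algebra k B] [Algebra k C] (f : A →ₐ[k] C) (g : B →ₐ[k] C) (h : f.range = g.range)
    (I : Ideal A) (J : Ideal B) [I.IsTwoSided] [J.IsTwoSided] (hI : RingHom.ker f = I)
    (hJ : RingHom.ker g = J) : Nonempty ((A ⧸ I) ≃ₐ[k] (B ⧸ J)) := by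
  subst hI hJ
  exact ⟨(Ideal.quotientKerEquivRange f).trans
    ((Subalgebra.equivOfEq _ _ h).trans (Ideal.quotientKerEquivRange g).symm)⟩

/-! ### The completed path algebra, its truncations, and the comparison of the two maps. -/

section Completion

open PathAlgebra

variable {k : Type w} [Field k] {Q : Type u} [Quiver.{v} Q] [Fintype Q]

theorem sum_coeffHom_smul {R : Type*} [CommRing R] (z : PathAlgebra R Q) :
    ∃ s : Finset (AnyPath Q), z = ∑ p ∈ s, coeffHom R p z • ofPath R p := by
  refine ⟨((basis R Q).repr z).support, ?_⟩
  conv_lhs => rw [← (basis R Q).linearCombination_repr z]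
  rfl

theorem mem_arrowIdeal_pow_iff {d : ℕ} {z : PathAlgebra k Q} :
    z ∈ (arrowIdeal k Q).asIdeal ^ d ↔
      ∀ p : AnyPath Q, p.2.2.length < d → coeffHom k p z = 0 := by
  refine ⟨fun hz p hp => coeffHom_eq_zero_of_mem_pathSpan (mem_pathSpan_of_mem_arrowIdeal_pow hz)
    (by simpa using hp), fun h => ?_⟩
  obtain ⟨s, hs⟩ := sum_coeffHom_smul z
  rw [hs]
  refine sum_mem fun p _ => ?_
  by_cases hp : p.2.2.length < d
  · rw [h p hp, zero_smul]
    exact zero_mem _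
  · rw [← one_mul (ofPath k p), ← smul_mul_assoc]
    exact Ideal.mul_mem_left _ _
      (Ideal.pow_le_pow_right (not_lt.mp hp) (ofPath_mem_arrowIdeal_pow p.2.2))

instance sup_isTwoSided {A : Type*} [Ring A] (I J : Ideal A) [I.IsTwoSided] [J.IsTwoSided] :
    (I ⊔ J).IsTwoSided where
  mul_mem_of_left {a} b ha := by
    obtain ⟨x, hx, y, hy, rfl⟩ := Submodule.mem_sup.mp ha
    rw [add_mul]
    exact add_mem (Ideal.mem_sup_left (I.mul_mem_right b hx))
      (Ideal.mem_sup_right (J.mul_mem_right b hy))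

/-- The ideal `⟨Z⟩ + B ^ d`. -/
def truncIdeal (k : Type w) [Field k] (Z : Set (AnyPath Q)) (d : ℕ) : Ideal (PathAlgebra k Q) :=
  (relationIdeal k Z).asIdeal ⊔ (arrowIdeal k Q).asIdeal ^ d

instance (Z : Set (AnyPath Q)) (d : ℕ) : (truncIdeal k Z d).IsTwoSided :=
  inferInstanceAs (_ ⊔ _ : Ideal _).IsTwoSided

variable {Z : Set (AnyPath Q)}

theorem coeffHom_eq_zero_of_mem_truncIdeal {d : ℕ} {z : PathAlgebra k Q}
    (hz : z ∈ truncIdeal k Z d) {p : AnyPath Q} (hp : IsAdmissible Z p.2.2)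
    (hd : p.2.2.length < d) : coeffHom k p z = 0 := by
  obtain ⟨x, hx, y, hy, rfl⟩ := Submodule.mem_sup.mp hz
  rw [map_add, mem_arrowIdeal_pow_iff.mp hy p hd, add_zero]
  exact coeffHom_eq_zero_of_mem_pathSpan (mem_pathSpan_of_mem_relationIdeal hx)
    (fun h => h hp)

theorem truncHom_ofPath {n d : ℕ}
    {θ : PathAlgebra (MvPowerSeries (Fin n) k) Q →ₐ[k] PathAlgebra k Q ⧸ truncIdeal k Z d}
    {ρ : MvPowerSeries (Fin n) k →ₐ[k] PathAlgebra k Q ⧸ truncIdeal k Z d}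
    (hθ : ∀ r p, θ (r • ofPath _ p) = ρ r * Ideal.Quotient.mk _ (ofPath k p)) (p : AnyPath Q) :
    θ (ofPath _ p) = Ideal.Quotient.mk _ (ofPath k p) := by
  have := hθ 1 p
  rwa [one_smul, map_one, one_mul] at this

variable (k Z) in
/-- The homomorphism from the completed path algebra to the product of the truncations. -/
def completionToTrunc : Completion k (arrowIdeal k Q).asIdeal →ₐ[k]
    ∀ d, PathAlgebra k Q ⧸ truncIdeal k Z d :=
  AlgHom.pi fun d => (Ideal.Quotient.factorₐ k le_sup_right).comp
    ((Pi.evalAlgHom k _ d).comp (Completion k (arrowIdeal k Q).asIdeal).val)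

/-- In degree `d` a representative lies in `⟨Z⟩ + B^d` exactly when it is congruent modulo `B^d` to
an element of `⟨Z⟩`. -/
theorem ker_completionToTrunc :
    RingHom.ker (completionToTrunc k Z) =
      closureIdeal k (arrowIdeal k Q).asIdeal (relationIdeal k Z).asIdeal := by
  ext x
  rw [RingHom.mem_ker, funext_iff]
  refine forall_congr' fun d => ?_
  obtain ⟨y, hy⟩ := Ideal.Quotient.mk_surjective (x.1 d)
  have h1 : completionToTrunc k Z x d = Ideal.Quotient.mk (truncIdeal k Z d) y := by
    change Ideal.Quotient.factorₐ k (show _ ≤ truncIdeal k Z d from le_sup_right) (x.1 d) = _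
    rw [← hy]
    rfl
  rw [h1, ← hy, Pi.zero_apply, Ideal.Quotient.eq_zero_iff_mem, truncIdeal, Submodule.mem_sup]
  constructor
  · rintro ⟨h, hh, b, hb, rfl⟩
    refine ⟨h, hh, ?_⟩
    rw [Ideal.Quotient.eq, add_sub_cancel_left]
    exact hb
  · rintro ⟨h, hh, he⟩
    exact ⟨h, hh, y - h, Ideal.Quotient.eq.mp he, by abel⟩

variable [∀ x y : Q, Finite (x ⟶ y)]

/-- The truncation of a family of coefficients to the paths of length less than `d`. -/
def truncSum (a : AnyPath Q → k) (d : ℕ) : PathAlgebra k Q :=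
  ∑ p ∈ (finite_setOf_length_lt (Q := Q) d).toFinset, a p • ofPath k p

theorem coeffHom_truncSum (a : AnyPath Q → k) {d : ℕ} {p : AnyPath Q} (hp : p.2.2.length < d) :
    coeffHom k p (truncSum a d) = a p := by
  rw [truncSum, map_sum, Finset.sum_eq_single_of_mem p (by simpa using hp)]
  · rw [map_smul, coeffHom_ofPath_self, smul_eq_mul, mul_one]
  · intro q _ hq
    rw [map_smul, coeffHom_ofPath_of_ne hq, smul_zero]

theorem mk_truncSum_eq {a : AnyPath Q → k} {d : ℕ} {z : PathAlgebra k Q}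
    (h : ∀ p : AnyPath Q, p.2.2.length < d → coeffHom k p z = a p) :
    Ideal.Quotient.mk ((arrowIdeal k Q).asIdeal ^ d) z =
      Ideal.Quotient.mk ((arrowIdeal k Q).asIdeal ^ d) (truncSum a d) := by
  rw [Ideal.Quotient.eq, mem_arrowIdeal_pow_iff]
  intro p hp
  rw [map_sub, h p hp, coeffHom_truncSum a hp, sub_self]

/-- The element of the completed path algebra with given coefficients. -/
def ofCoeffs (a : AnyPath Q → k) : Completion k (arrowIdeal k Q).asIdeal :=
  ⟨fun d => Ideal.Quotient.mk _ (truncSum a d), fun d d' h => by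
    change Ideal.Quotient.mk _ (truncSum a d') = _
    exact mk_truncSum_eq fun p hp => coeffHom_truncSum a (by omega)⟩

theorem exists_eq_ofCoeffs (x : Completion k (arrowIdeal k Q).asIdeal) : ∃ a, x = ofCoeffs a := by
  choose y hy using fun d => Ideal.Quotient.mk_surjective (x.1 d)
  -- The first quotient in which the coefficient of `p` is visible is the one by `B^(p.length + 1)`.
  refine ⟨fun p => coeffHom k p (y (p.2.2.length + 1)), Subtype.ext (funext fun d => ?_)⟩
  rw [← hy d]
  refine mk_truncSum_eq fun p hp => ?_
  have h := x.2 (show p.2.2.length + 1 ≤ d by omega)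
  rw [← hy, ← hy] at h
  change Ideal.Quotient.mk _ (y d) = _ at h
  rw [Ideal.Quotient.eq, mem_arrowIdeal_pow_iff] at h
  have := h p (by omega)
  rwa [map_sub, sub_eq_zero] at this

theorem completionToTrunc_ofCoeffs (a : AnyPath Q → k) (d : ℕ) :
    completionToTrunc k Z (ofCoeffs a) d = Ideal.Quotient.mk (truncIdeal k Z d) (truncSum a d) :=
  rfl

/-! ### The homomorphisms from the path algebra over power series to the truncations -/

variable {n : ℕ} {e : Fin n ≃ NerveParts Z}

variable (k e) in
-- `partSigma` is central modulo `⟨Z⟩`, and its `d`-th power lies in `B^d`, so it may be substituted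
-- for `t_i`.
theorem exists_truncHom (hZ : IsSpecial Z) (d : ℕ) :
    ∃ (θ : PathAlgebra (MvPowerSeries (Fin n) k) Q →ₐ[k] PathAlgebra k Q ⧸ truncIdeal k Z d)
      (ρ : MvPowerSeries (Fin n) k →ₐ[k] PathAlgebra k Q ⧸ truncIdeal k Z d),
      (∀ r p, θ (r • ofPath _ p) = ρ r * Ideal.Quotient.mk _ (ofPath k p)) ∧
      ∀ i, ρ (MvPowerSeries.X i) = Ideal.Quotient.mk _ (partSigma k e i) := by
  obtain ⟨ρ, hρ, hX⟩ := exists_mvPowerSeries_algHom (k := k)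
    (fun i => Ideal.Quotient.mk (truncIdeal k Z d) (partSigma k e i))
    (fun i => by
      rw [Subalgebra.mem_center_iff]
      intro b
      obtain ⟨z, rfl⟩ := Ideal.Quotient.mk_surjective b
      rw [← map_mul, ← map_mul, eq_comm, Ideal.Quotient.eq]
      exact Ideal.mem_sup_left (partSigma_mul_sub_mem e hZ i z))
    (fun i => ⟨d, by
      rw [← map_pow, Ideal.Quotient.eq_zero_iff_mem]
      exact Ideal.mem_sup_right (Ideal.pow_mem_pow (partSigma_mem_arrowIdeal e hZ i) d)⟩)
  obtain ⟨θ, hθ⟩ := exists_pathAlgebra_algHom ρ hρ (Ideal.Quotient.mkₐ k (truncIdeal k Z d))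
  exact ⟨θ, ρ, hθ, hX⟩

variable {d : ℕ}
  {θ : PathAlgebra (MvPowerSeries (Fin n) k) Q →ₐ[k] PathAlgebra k Q ⧸ truncIdeal k Z d}
  {ρ : MvPowerSeries (Fin n) k →ₐ[k] PathAlgebra k Q ⧸ truncIdeal k Z d}

theorem truncHom_eq_zero_of_mem (hZ : IsSpecial Z)
    (hθ : ∀ r p, θ (r • ofPath _ p) = ρ r * Ideal.Quotient.mk _ (ofPath k p))
    (hρ : ∀ i, ρ (MvPowerSeries.X i) = Ideal.Quotient.mk _ (partSigma k e i))
    {y : PathAlgebra (MvPowerSeries (Fin n) k) Q} (hy : y ∈ powerIdeal k e) : θ y = 0 := by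
  classical
  have hσ : ∀ x, θ (sigma _ Z x) = Ideal.Quotient.mk _ (sigma k Z x) := fun x => by
    rw [sigma_eq_sum hZ, sigma_eq_sum hZ, map_sum, map_sum]
    exact Finset.sum_congr rfl fun c _ => truncHom_ofPath hθ _
  have hX : ∀ i x, θ ((MvPowerSeries.X i : MvPowerSeries (Fin n) k) • vertex _ x) =
      if x ∈ part e i then Ideal.Quotient.mk _ (sigma k Z x) else 0 := fun i x => by
    rw [vertex, hθ, hρ, ← map_mul, partSigma_mul_ofPath e hZ]
    split_ifs
    · exact congrArg _ (sigma_mul_vertex hZ x)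
    · exact map_zero _
  have hle : powerIdeal k e ≤ TwoSidedIdeal.ker θ := by
    refine sup_le (TwoSidedIdeal.span_le.mpr ?_)
      (iSup_le fun i => sup_le (TwoSidedIdeal.span_le.mpr ?_) (TwoSidedIdeal.span_le.mpr ?_))
    · rintro _ ⟨p, hp, rfl⟩
      refine (TwoSidedIdeal.mem_ker _).mpr ?_
      rw [truncHom_ofPath hθ, Ideal.Quotient.eq_zero_iff_mem]
      exact Ideal.mem_sup_left (TwoSidedIdeal.subset_span ⟨p, hp, rfl⟩)
    · rintro _ ⟨x, hx, rfl⟩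
      refine (TwoSidedIdeal.mem_ker _).mpr ?_
      rw [map_sub, hX, hσ, if_pos hx, sub_self]
    · rintro _ ⟨x, hx, rfl⟩
      refine (TwoSidedIdeal.mem_ker _).mpr ?_
      rw [hX, if_neg hx]
  exact (TwoSidedIdeal.mem_ker _).mp (hle hy)

/-- Only one variable `t_i` can occur in the series, and the vanishing coefficients make it
divisible by `t_i^d`, whose image lies in `B^d`. -/
theorem truncHom_smul_eq_zero (hZ : IsSpecial Z)
    (hθ : ∀ r p, θ (r • ofPath _ p) = ρ r * Ideal.Quotient.mk _ (ofPath k p))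
    (hρ : ∀ i, ρ (MvPowerSeries.X i) = Ideal.Quotient.mk _ (partSigma k e i))
    {a : AnyPath Q → k} {p : AnyPath Q} (ha : ∀ m ≤ d, a (extend Z p m) = 0) :
    θ (extensionSeries e p a • ofPath _ p) = 0 := by
  classical
  rw [hθ]
  by_cases hp : IsPeriodic Z p
  · obtain ⟨i, hi⟩ := exists_isPeriodicAt e hp
    have hdvd : MvPowerSeries.X i ^ d ∣ extensionSeries e p a := by
      rw [MvPowerSeries.X_pow_dvd_iff]
      intro α hα
      rw [coeff_extensionSeries]
      split_ifs with h
      · refine ha _ ?_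
        rw [eq_single_of_mem_exponents hi h] at hα
        simp only [Finsupp.single_eq_same] at hα
        exact hα.le
      · rfl
    obtain ⟨g, hg⟩ := hdvd
    rw [hg, map_mul, map_pow, hρ, ← map_pow, Ideal.Quotient.eq_zero_iff_mem.mpr, zero_mul, zero_mul]
    exact Ideal.mem_sup_right (Ideal.pow_mem_pow (partSigma_mem_arrowIdeal e hZ i) d)
  · rw [extensionSeries_eq_zero, map_zero, zero_mul]
    intro m hm
    exact ha m (by rcases hm with rfl | hm; exacts [Nat.zero_le _, absurd hm hp])

/-- A normal form involves infinitely many coefficients, so additivity alone does not suffice. The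
family is cut into finitely many single coefficients, handled by `normalForm_single_sub_mem`, and a
tail that `θ` kills. -/
theorem truncHom_normalForm (hZ : IsSpecial Z)
    (hθ : ∀ r p, θ (r • ofPath _ p) = ρ r * Ideal.Quotient.mk _ (ofPath k p))
    (hρ : ∀ i, ρ (MvPowerSeries.X i) = Ideal.Quotient.mk _ (partSigma k e i))
    (a : AnyPath Q → k) :
    θ (normalForm e hZ a) = Ideal.Quotient.mk _ (truncSum a d) := by
  classical
  -- `D` exceeds the lengths of the first `d` extensions of all reduced paths, of which there are
  -- finitely many; so the tail vanishes on these extensions.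
  obtain ⟨D, hdD, hD⟩ : ∃ D, d ≤ D ∧ ∀ p, IsReduced Z p → ∀ m ≤ d,
      (extend Z p m).2.2.length < D := by
    refine ⟨d + 1 + ∑ p ∈ (finite_setOf_isReduced hZ).toFinset, (extend Z p d).2.2.length, by omega,
      fun p hp m hm => ?_⟩
    have h1 : (extend Z p m).2.2.length ≤ (extend Z p d).2.2.length := by
      rw [length_extend, length_extend]
      gcongr
    have h2 := Finset.single_le_sum (f := fun p => (extend Z p d).2.2.length)
      (fun _ _ => Nat.zero_le _) ((Set.Finite.mem_toFinset (finite_setOf_isReduced hZ)).mpr hp)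
    omega
  set s := (finite_setOf_length_lt (Q := Q) D).toFinset with hs
  let a' : AnyPath Q → k := fun p => if p.2.2.length < D then 0 else a p
  have hsplit : a = ∑ p ∈ s, a p • Pi.single p (1 : k) + a' := by
    funext q
    rw [Pi.add_apply, Finset.sum_apply]
    simp only [Pi.smul_apply, Pi.single_apply, smul_eq_mul, mul_ite, mul_one, mul_zero,
      Finset.sum_ite_eq, a']
    by_cases hq : q.2.2.length < D
    · rw [if_pos (by simpa [hs] using hq), if_pos hq, add_zero]
    · rw [if_neg (by simpa [hs] using hq), if_neg hq, zero_add]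
  have hsingle : ∀ p, θ (normalForm e hZ (Pi.single p (1 : k))) =
      Ideal.Quotient.mk _ (ofPath k p) := fun p => by
    rw [← truncHom_ofPath hθ, ← sub_eq_zero, ← map_sub]
    exact truncHom_eq_zero_of_mem hZ hθ hρ (normalForm_single_sub_mem hZ p)
  have htail : θ (normalForm e hZ a') = 0 := by
    rw [normalForm_apply, map_sum]
    refine Finset.sum_eq_zero fun p hp => truncHom_smul_eq_zero hZ hθ hρ fun m hm => ?_
    have hp' : IsReduced Z p := by simpa using hp
    exact if_pos (hD p hp' m hm)
  have hmk : ∀ (c : k) (z : PathAlgebra k Q),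
      c • Ideal.Quotient.mk (truncIdeal k Z d) z = Ideal.Quotient.mk (truncIdeal k Z d) (c • z) :=
    fun _ _ => rfl
  conv_lhs => rw [hsplit]
  rw [map_add, map_add, htail, add_zero, map_sum, map_sum, truncSum, map_sum]
  simp only [map_smul, hsingle, hmk]
  -- The paths of length between `d` and `D` lie in `B^d` and contribute nothing.
  refine (Finset.sum_subset ?_ ?_).symm
  · intro p hp
    simp only [hs, Set.Finite.mem_toFinset, Set.mem_ofPred_eq] at hp ⊢
    omega
  · intro p _ hp
    simp only [Set.Finite.mem_toFinset, Set.mem_ofPred_eq, not_lt] at hp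
    rw [← hmk, Ideal.Quotient.eq_zero_iff_mem.mpr, smul_zero]
    exact Ideal.mem_sup_right
      (Ideal.pow_le_pow_right hp (ofPath_mem_arrowIdeal_pow p.2.2))

variable (k e) in
/-- There is a homomorphism from the path algebra over power series to the product of the
truncations, which vanishes on the ideal and sends normal forms to the sums they represent. -/
theorem exists_truncPiHom (hZ : IsSpecial Z) :
    ∃ Θ : PathAlgebra (MvPowerSeries (Fin n) k) Q →ₐ[k] ∀ d, PathAlgebra k Q ⧸ truncIdeal k Z d,
      (∀ y ∈ powerIdeal k e, Θ y = 0) ∧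
      ∀ a, Θ (normalForm e hZ a) = completionToTrunc k Z (ofCoeffs a) := by
  choose θ ρ hθ hρ using exists_truncHom k e hZ
  refine ⟨AlgHom.pi θ, fun y hy => ?_, fun a => ?_⟩
  · funext d
    exact truncHom_eq_zero_of_mem hZ (hθ d) (hρ d) hy
  · funext d
    exact truncHom_normalForm hZ (hθ d) (hρ d) a

/-- The truncation of level `p.length + 1` detects the coefficient of an admissible path `p`, and a
normal form depends on those coefficients only. -/
theorem normalForm_eq_zero_of_completionToTrunc (hZ : IsSpecial Z) {a : AnyPath Q → k}
    (h : completionToTrunc k Z (ofCoeffs a) = 0) : normalForm e hZ a = 0 := by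
  refine normalForm_eq_zero hZ fun p hp => ?_
  have h1 := congrFun h (p.2.2.length + 1)
  rw [completionToTrunc_ofCoeffs, Pi.zero_apply, Ideal.Quotient.eq_zero_iff_mem] at h1
  have h2 := coeffHom_eq_zero_of_mem_truncIdeal h1 hp (by omega)
  rwa [coeffHom_truncSum a (by omega)] at h2

end Completion

end StringAlg

end

theorem proposition1p4 {k : Type*} [Field k] {Q : Type*} [Quiver Q] [Fintype Q]
    [∀ x y : Q, Finite (x ⟶ y)] (hQ : StringAlg.IsBiserial Q)
    (Z : Set (StringAlg.AnyPath Q)) (hlen : ∀ p ∈ Z, 2 ≤ p.2.2.length)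
    (hZ : StringAlg.IsSpecial Z)
    (n : ℕ) (e : Fin n ≃ StringAlg.NerveParts Z) :
    Nonempty (StringAlg.CompletedStringAlgebra k Z ≃ₐ[k]
      StringAlg.PathAlgebra (MvPowerSeries (Fin n) k) Q ⧸
        (StringAlg.stringIdeal Z e
          (fun i => (MvPowerSeries.X i : MvPowerSeries (Fin n) k))).asIdeal) := by
  obtain ⟨Θ, hI, hΘ⟩ := StringAlg.exists_truncPiHom k e hZ
  have hnf := StringAlg.exists_normalForm (e := e) (k := k) hlen hZ
  have hcongr : ∀ y a, y - StringAlg.normalForm e hZ a ∈ StringAlg.powerIdeal k e →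
      Θ y = StringAlg.completionToTrunc k Z (StringAlg.ofCoeffs a) := fun y a h => by
    rw [← hΘ, ← sub_eq_zero, ← map_sub]
    exact hI _ h
  refine StringAlg.nonempty_quotient_algEquiv (StringAlg.completionToTrunc k Z) Θ ?_ _ _
    StringAlg.ker_completionToTrunc ?_
  · ext z
    constructor
    · rintro ⟨x, rfl⟩
      obtain ⟨a, rfl⟩ := StringAlg.exists_eq_ofCoeffs x
      exact ⟨StringAlg.normalForm e hZ a, hΘ a⟩
    · rintro ⟨y, rfl⟩
      obtain ⟨a, ha⟩ := hnf y
      exact ⟨StringAlg.ofCoeffs a, (hcongr y a ha).symm⟩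
  · ext y
    rw [RingHom.mem_ker]
    refine ⟨fun hy => ?_, fun hy => hI y hy⟩
    obtain ⟨a, ha⟩ := hnf y
    -- Since `y` maps to zero, so does the series `a`; its normal form is then zero in `RQ`, and `y`
    -- is congruent to it.
    have h0 := (hcongr y a ha).symm.trans hy
    rw [StringAlg.normalForm_eq_zero_of_completionToTrunc hZ h0, sub_zero] at ha
    exact ha
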